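/- Let $\mathcal{O}=\mathbb{C}\{x,y\}$ be the local ring of holomorphic germs at $0\in\mathbb{C}^2$. For an ideal $I$ in an algebra $S$ over a ring $R$, let $\mathrm{Der}_R(-\log I)$ be the module of $R$-linear derivations of $S$ that map $I$ into $I$. Let $D=V(f)\subset(\mathbb{C}^2,0)$ be a plane curve germ. An admissible deformation of $D$ over a local Artinian $\mathbb{C}$-algebra $A$ with residue field $\mathbb{C}$ and maximal ideal $\mathfrak{m}$ is an ideal $I$ of $\mathcal{O}_A=A\otimes_{\mathbb{C}}\mathcal{O}$ such that $\mathcal{O}_A/I$ is flat over $A$, the image of $I$ in $\mathcal{O}_A/\mathfrak{m}\mathcal{O}_A=\mathcal{O}$ is $(f)$, and restriction modulo $\mathfrak{m}$ induces an identification $$\mathrm{Der}_A(-\log I)/\mathfrak{m}\,\mathrm{Der}_A(-\log I)=\mathrm{Der}_{\mathbb{C}}(-\log (f)).$$ Two of them, $I$ and $I'$, are isomorphic if there is an $A$-algebra isomorphism $\mathcal{O}_A/I\cong\mathcal{O}_A/I'$ inducing the identity on $\mathcal{O}/(f)$. Let $\mathbf{FD}_D(A)$ be the set of isomorphism classes,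 with base change as the effect on morphisms, and let $\mathcal{FT}^1(D)=\mathbf{FD}_D(\mathbb{C}[\epsilon])$, $\epsilon^2=0$, with the usual operations of the tangent space of a deformation functor: $a+b=c$ if and only if some class over $\mathbb{C}[\epsilon_1,\epsilon_2]/(\epsilon_1,\epsilon_2)^2=\mathbb{C}[\epsilon]\times_{\mathbb{C}}\mathbb{C}[\epsilon]$ maps to $a$, to $b$ and to $c$ under $(\epsilon_1,\epsilon_2)\mapsto(\epsilon,0)$, $(0,\epsilon)$ and $(\epsilon,\epsilon)$ respectively; and $t\cdot a$, for $t\in\mathbb{C}$, is the image of $a$ under $\epsilon\mapsto t\epsilon$. **Theorem.** Let $f\in\mathbb{C}[x,y]$ be weighted homogeneous of degree $k$ with respect to positive integer weights of $x$ and $y$, with $f(0)=0$, and suppose that $f$ is reduced (squarefree) in $\mathcal{O}$. Let $D=V(f)\subset(\mathbb{C}^2,0)$, let $\mathbb{C}[x,y]_k$ be the space of weighted homogeneous polynomials of degree $k$, and let $J(D)=(\partial f/\partial x,\partial f/\partial y)\subset\mathbb{C}[x,y]$. Then the operations above are well defined and make $\mathcal{FT}^1(D)$ a complex vector space, and there is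 an isomorphism of complex vector spaces $$\mathcal{FT}^1(D)\cong\mathbb{C}[x,y]_k/(J(D)\cap\mathbb{C}[x,y]_k).$$ If moreover $f$ is homogeneous of degree $d$ in the usual sense, then $\dim_{\mathbb{C}}\mathcal{FT}^1(D)=d-3$ if $d\ge 3$, and $\dim_{\mathbb{C}}\mathcal{FT}^1(D)=0$ otherwise. -/

import Mathlib

open scoped TensorProduct

noncomputable section

namespace FreeDivisor

/-! ### The local ring of holomorphic germs at the origin -/

/-- A power series converges (absolutely) on some closed polydisc of positive radius. -/
def IsConvergent {n : ℕ} (f : MvPowerSeries (Fin n) ℂ) : Prop :=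
  ∃ r : ℝ, 0 < r ∧
    Summable (fun a : Fin n →₀ ℕ => ‖MvPowerSeries.coeff a f‖ * r ^ a.degree)

theorem summable_of_le {n : ℕ} {f : MvPowerSeries (Fin n) ℂ} {r s : ℝ} (hs : 0 ≤ s) (hsr : s ≤ r)
    (h : Summable (fun a : Fin n →₀ ℕ => ‖MvPowerSeries.coeff a f‖ * r ^ a.degree)) :
    Summable (fun a : Fin n →₀ ℕ => ‖MvPowerSeries.coeff a f‖ * s ^ a.degree) :=
  Summable.of_nonneg_of_le (fun _ => by positivity) (fun _ => by gcongr) h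

theorem isConvergent_of_finite {n : ℕ} {f : MvPowerSeries (Fin n) ℂ} (s : Finset (Fin n →₀ ℕ))
    (h : ∀ a ∉ s, MvPowerSeries.coeff a f = 0) : IsConvergent f :=
  ⟨1, one_pos, summable_of_ne_finset_zero (s := s) fun a ha => by simp [h a ha]⟩

theorem IsConvergent.add {n : ℕ} {f g : MvPowerSeries (Fin n) ℂ} (hf : IsConvergent f)
    (hg : IsConvergent g) : IsConvergent (f + g) := by
  obtain ⟨r, hr, hf⟩ := hf
  obtain ⟨s, hs, hg⟩ := hg
  have hm : 0 < min r s := lt_min hr hs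
  refine ⟨min r s, hm, Summable.of_nonneg_of_le (fun _ => by positivity) (fun a => ?_)
    ((summable_of_le hm.le (min_le_left r s) hf).add
      (summable_of_le hm.le (min_le_right r s) hg))⟩
  rw [← add_mul, map_add]
  gcongr
  exact norm_add_le _ _

theorem IsConvergent.mul {n : ℕ} {f g : MvPowerSeries (Fin n) ℂ} (hf : IsConvergent f)
    (hg : IsConvergent g) : IsConvergent (f * g) := by
  classical
  obtain ⟨r, hr, hf⟩ := hf
  obtain ⟨s, hs, hg⟩ := hg
  have hm : 0 < min r s := lt_min hr hs
  have hf' := summable_of_le hm.le (min_le_left r s) hf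
  have hg' := summable_of_le hm.le (min_le_right r s) hg
  have h0 := Summable.mul_of_nonneg hf' hg' (fun _ => by positivity) (fun _ => by positivity)
  have key := summable_sum_mul_antidiagonal_of_summable_mul
    (f := fun a : Fin n →₀ ℕ => ‖MvPowerSeries.coeff a f‖ * min r s ^ a.degree)
    (g := fun a : Fin n →₀ ℕ => ‖MvPowerSeries.coeff a g‖ * min r s ^ a.degree) h0
  refine ⟨min r s, hm, Summable.of_nonneg_of_le (fun _ => by positivity) (fun a => ?_) key⟩
  rw [MvPowerSeries.coeff_mul]
  refine (mul_le_mul_of_nonneg_right (norm_sum_le _ _) (by positivity)).trans ?_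
  rw [Finset.sum_mul]
  refine Finset.sum_le_sum fun p hp => le_of_eq ?_
  rw [← Finset.HasAntidiagonal.mem_antidiagonal.mp hp, map_add, pow_add, norm_mul]
  ring

/-- The ring `𝒪_{ℂⁿ,0} = ℂ{x₁, …, xₙ}` of convergent power series, as a subalgebra of the formal
power series. -/
def convergent (n : ℕ) : Subalgebra ℂ (MvPowerSeries (Fin n) ℂ) where
  carrier := {f | IsConvergent f}
  mul_mem' := IsConvergent.mul
  add_mem' := IsConvergent.add
  algebraMap_mem' c := by
    classical
    refine isConvergent_of_finite {0} fun a ha => ?_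
    rw [MvPowerSeries.algebraMap_apply, MvPowerSeries.coeff_C, if_neg (by simpa using ha)]

/-- The local ring `𝒪_{ℂⁿ,0}`. -/
abbrev HolGerm (n : ℕ) : Type := convergent n

/-- The germ at `0` of the `i`-th coordinate function. -/
def coord {n : ℕ} (i : Fin n) : HolGerm n :=
  ⟨MvPowerSeries.X i, by
    classical
    refine isConvergent_of_finite {Finsupp.single i 1} fun a ha => ?_
    rw [MvPowerSeries.coeff_X, if_neg (by simpa using ha)]⟩

/-- The germ at `0` of a polynomial. -/
def polyGerm (n : ℕ) : MvPolynomial (Fin n) ℂ →ₐ[ℂ] HolGerm n :=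
  MvPolynomial.aeval coord

/-! ### Logarithmic vector fields -/

/-- The `R`-linear derivations of `S` preserving the ideal `I`. For `R = ℂ`, `S = 𝒪_{ℂⁿ,0}` and
`I = (f)` this is `Der(-log D)`; for `R = 𝒪_S`, `S = 𝒪_{ℂⁿ × S}` and `I` the ideal of `X` it is
`Der(-log X/S)`. -/
def logDer (R : Type*) {S : Type*} [CommRing R] [CommRing S] [Algebra R S] (I : Ideal S) :
    Submodule S (Derivation R S S) where
  carrier := {θ | ∀ g ∈ I, θ g ∈ I}
  zero_mem' _ _ := by simp
  add_mem' hθ hη g hg := by simpa using I.add_mem (hθ g hg) (hη g hg)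
  smul_mem' c θ hθ g hg := by simpa using I.mul_mem_left c (hθ g hg)

/-! ### Admissible deformations

The base is a fat point with local ring `A`, a local Artinian `ℂ`-algebra with residue field `ℂ`;
the residue map is `π : A → ℂ`, so the maximal ideal is `ker π`. As `A` is finite dimensional,
`𝒪_{ℂⁿ × S,0} = A ⊗ 𝒪_{ℂⁿ,0}`. -/

section Deformations

variable {n : ℕ} {A : Type} [CommRing A] [Algebra ℂ A]

/-- Restriction of functions from `ℂⁿ × S` to the fibre `ℂⁿ` over the closed point. -/
def restrictFun (n : ℕ) (π : A →ₐ[ℂ] ℂ) : A ⊗[ℂ] HolGerm n →ₐ[ℂ] HolGerm n :=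
  Algebra.TensorProduct.lift ((Algebra.ofId ℂ (HolGerm n)).comp π) (AlgHom.id ℂ (HolGerm n))
    (fun _ _ => Commute.all _ _)

theorem restrictFun_tmul (π : A →ₐ[ℂ] ℂ) (a : A) (g : HolGerm n) :
    restrictFun n π (a ⊗ₜ g) = π a • g := by
  simp [restrictFun, Algebra.ofId_apply, Algebra.smul_def]

/-- Restriction of relative vector fields on `ℂⁿ × S` to the fibre over the closed point. -/
def restrictDer (π : A →ₐ[ℂ] ℂ) (θ : Derivation A (A ⊗[ℂ] HolGerm n) (A ⊗[ℂ] HolGerm n)) :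
    Derivation ℂ (HolGerm n) (HolGerm n) :=
  Derivation.mk'
    ((restrictFun n π).toLinearMap ∘ₗ (θ.toLinearMap.restrictScalars ℂ) ∘ₗ
      (Algebra.TensorProduct.includeRight : HolGerm n →ₐ[ℂ] A ⊗[ℂ] HolGerm n).toLinearMap)
    (fun g h => by
      have e : (1 : A) ⊗ₜ[ℂ] (g * h) = (1 ⊗ₜ g) * (1 ⊗ₜ h) := by simp
      simp only [LinearMap.comp_apply, LinearMap.coe_restrictScalars, AlgHom.toLinearMap_apply,
        Algebra.TensorProduct.includeRight_apply, Derivation.coeFn_coe]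
      rw [e, Derivation.leibniz]
      simp [restrictFun_tmul])

/-- An admissible deformation over `S = Spec A` of the germ `D = V(f) ⊂ (ℂⁿ,0)`: a closed subgerm
`X ⊂ ℂⁿ × S`, flat over `S`, with central fibre `D`, such that restriction to the central fibre
identifies `Der(-log X/S) / 𝔪_S Der(-log X/S)` with `Der(-log D)`. -/
structure AdmissibleDeformation (f : HolGerm n) (π : A →ₐ[ℂ] ℂ) where
  /-- the ideal of the total space `X` -/
  ideal : Ideal (A ⊗[ℂ] HolGerm n)
  flat : Module.Flat A ((A ⊗[ℂ] HolGerm n) ⧸ ideal)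
  centralFibre : ideal.map (restrictFun n π) = Ideal.span {f}
  /-- the restriction of vector fields maps `Der(-log X/S)` onto `Der(-log D)` … -/
  restrict_image : restrictDer π '' (logDer A ideal : Set (Derivation A (A ⊗[ℂ] HolGerm n) (A ⊗[ℂ] HolGerm n))) =
    (logDer ℂ (Ideal.span {f}) : Set (Derivation ℂ (HolGerm n) (HolGerm n)))
  /-- … with kernel `𝔪_S Der(-log X/S)` -/
  restrict_kernel : ∀ θ ∈ logDer A ideal, restrictDer π θ = 0 ↔
    θ ∈ (RingHom.ker π).map (algebraMap A (A ⊗[ℂ] HolGerm n)) • logDer A ideal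

namespace AdmissibleDeformation

variable {f : HolGerm n} {π : A →ₐ[ℂ] ℂ}

/-- The closed embedding `D → X`, on functions. -/
def toFibre (X : AdmissibleDeformation f π) :
    (A ⊗[ℂ] HolGerm n) ⧸ X.ideal →+* HolGerm n ⧸ Ideal.span {f} :=
  Ideal.quotientMap (Ideal.span {f}) (restrictFun n π).toRingHom
    (Ideal.map_le_iff_le_comap.mp X.centralFibre.le)

/-- Two deformations over the same base `S` are isomorphic if there is an isomorphism of their
total spaces over `S` that is the identity on `D`. -/
def IsIsomorphic (X Y : AdmissibleDeformation f π) : Prop :=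
  ∃ τ : ((A ⊗[ℂ] HolGerm n) ⧸ X.ideal) ≃ₐ[A] ((A ⊗[ℂ] HolGerm n) ⧸ Y.ideal),
    ∀ z, Y.toFibre (τ z) = X.toFibre z

/-- Isomorphism of admissible deformations is an equivalence relation. -/
instance setoid (f : HolGerm n) (π : A →ₐ[ℂ] ℂ) : Setoid (AdmissibleDeformation f π) where
  r := IsIsomorphic
  iseqv :=
    { refl := fun _ => ⟨AlgEquiv.refl, fun _ => rfl⟩
      symm := fun ⟨τ, h⟩ => ⟨τ.symm, fun z => by rw [← h, AlgEquiv.apply_symm_apply]⟩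
      trans := fun ⟨τ, h⟩ ⟨σ, h'⟩ => ⟨τ.trans σ, fun z => by
        rw [AlgEquiv.trans_apply, h', h]⟩ }

/-- `Y` is the deformation induced from `X` by base change along `φ : A → B`. -/
def IsBaseChange {B : Type} [CommRing B] [Algebra ℂ B] {ρ : B →ₐ[ℂ] ℂ} (φ : A →ₐ[ℂ] B)
    (X : AdmissibleDeformation f π) (Y : AdmissibleDeformation f ρ) : Prop :=
  Y.ideal = X.ideal.map (Algebra.TensorProduct.map φ (AlgHom.id ℂ (HolGerm n)))

end AdmissibleDeformation

/-- `FD_D(A)`, the set of isomorphism classes of admissible deformations of `D = V(f)` over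
`Spec A`. -/
def FD (f : HolGerm n) (π : A →ₐ[ℂ] ℂ) : Type :=
  Quotient (AdmissibleDeformation.setoid f π)

/-- The class `b ∈ FD_D(B)` is the image of `a ∈ FD_D(A)` under `FD_D(φ)`. -/
def FD.MapsTo {f : HolGerm n} {π : A →ₐ[ℂ] ℂ} {B : Type} [CommRing B] [Algebra ℂ B]
    {ρ : B →ₐ[ℂ] ℂ} (φ : A →ₐ[ℂ] B) (a : FD f π) (b : FD f ρ) : Prop :=
  ∃ (X : AdmissibleDeformation f π) (Y : AdmissibleDeformation f ρ),
    Quotient.mk _ X = a ∧ Quotient.mk _ Y = b ∧ AdmissibleDeformation.IsBaseChange φ X Y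

end Deformations

/-! ### The tangent space `FT¹(D)` -/

/-- `FT¹(D) = FD_D(ℂ[ε])` with `ε² = 0`. -/
abbrev FT1 {n : ℕ} (f : HolGerm n) : Type :=
  FD f (TrivSqZeroExt.fstHom ℂ ℂ ℂ : DualNumber ℂ →ₐ[ℂ] ℂ)

/-- The addition of the tangent space of a deformation functor: `c = a + b` if `c` is the image,
under `FD_D` of the map `ε₁, ε₂ ↦ ε`, of a class over `ℂ[ε] ×_ℂ ℂ[ε] = ℂ[ε₁, ε₂]/(ε₁, ε₂)²` that
restricts to `a` and `b` along the two projections. Here `ℂ[ε₁, ε₂]/(ε₁, ε₂)²` is the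
square-zero extension of `ℂ` by `ℂ²`. -/
def FT1.IsSum {n : ℕ} {f : HolGerm n} (a b c : FT1 f) : Prop :=
  ∃ z : FD f (TrivSqZeroExt.fstHom ℂ ℂ (ℂ × ℂ)),
    FD.MapsTo (TrivSqZeroExt.map (LinearMap.fst ℂ ℂ ℂ)) z a ∧
    FD.MapsTo (TrivSqZeroExt.map (LinearMap.snd ℂ ℂ ℂ)) z b ∧
    FD.MapsTo (TrivSqZeroExt.map (LinearMap.fst ℂ ℂ ℂ + LinearMap.snd ℂ ℂ ℂ)) z c

/-- The scalar multiplication of the tangent space of a deformation functor: `b = t • a` if `b` is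
the image of `a` under `FD_D` of the map `ε ↦ t ε`. -/
def FT1.IsSMul {n : ℕ} {f : HolGerm n} (t : ℂ) (a b : FT1 f) : Prop :=
  FD.MapsTo (TrivSqZeroExt.map (t • (LinearMap.id : ℂ →ₗ[ℂ] ℂ))) a b

/-! ### The polynomial side -/

/-- The Jacobian ideal, generated by the partial derivatives of `f`. -/
def jacobianIdeal {n : ℕ} (f : MvPolynomial (Fin n) ℂ) : Ideal (MvPolynomial (Fin n) ℂ) :=
  Ideal.span (Set.range fun i => MvPolynomial.pderiv i f)

/-- `ℂ[x₁, …, xₙ]_k / (J(D) ∩ ℂ[x₁, …, xₙ]_k)` for the weights `w`. -/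
abbrev JacobianQuotient {n : ℕ} (w : Fin n → ℕ) (k : ℕ) (f : MvPolynomial (Fin n) ℂ) : Type :=
  MvPolynomial.weightedHomogeneousSubmodule ℂ w k ⧸
    ((jacobianIdeal f).restrictScalars ℂ).submoduleOf
      (MvPolynomial.weightedHomogeneousSubmodule ℂ w k)

end FreeDivisor

end

/-! Let `J` be the Jacobian ideal, `𝒪` the ring of germs and `E` the Euler field of the weights, so
that `E f = k f`. Since `k ≠ 0`, `f` lies in `J𝒪`.

Over a base whose maximal ideal has square zero and basis `εᵢ`, flatness forces the ideal of a
deformation to be generated by one element `f + ∑ gᵢ εᵢ` (`exists_eq_span_germMk`). Comparing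
`εᵢ`-coefficients, a field `θ` with `θ f = α f` lifts to a logarithmic field exactly when every `θ
gᵢ - α gᵢ` lies in `J𝒪`, because the correction terms `ηᵢ f` run through `J𝒪`. Once all fields lift,
the condition on the kernel is automatic (`deformationMk`). Isomorphisms change `gᵢ` exactly by
elements of `J𝒪` (`isIsomorphic_of_sub_mem`, `sub_mem_of_isIsomorphic`). Hence the tangent space is
the space of admissible `g` modulo `J𝒪`, and base change acts linearly on the `gᵢ`, which identifies
the operations (`isSum_iff`, `isSMul_iff`).

To compute that quotient, apply admissibility to `E`: `E g - k g ∈ J𝒪`. As `J` is homogeneous and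
contains powers of both variables, `g` may be replaced by a polynomial, and its component of weight
`m`, multiplied by `m - k`, lies in `J`; so only weight `k` survives (`exists_sub_polyGerm_mem`).
Conversely, let `p` have weight `k` and `θ f = α f`. Then `k θ - α E` kills `f`, so it is a multiple
of the Koszul field with coefficients in `J𝒪`, and it sends `p` to `k (θ p - α p)`, which is
therefore in `J𝒪` (`polyGerm_mem_admissibleGerms`).

The powers of the variables come from reducedness: the partial derivatives have no common factor
(`isRelPrime_pderiv`), elimination puts a nonzero polynomial in one variable into `J`, and
homogeneity isolates a monomial of it. In the homogeneous case of degree at least 3, the degree `d`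
part of `J` has dimension 4 inside a space of dimension `d + 1`. -/

noncomputable section

namespace FreeDivisor

/-! ### Elimination by resultants -/

section Resultant

open Polynomial

/-- Gauss's lemma: after clearing denominators, the primitive part of a common factor over the
fraction field is a common factor over `R`. -/
theorem isRelPrime_map_fractionRing {R : Type*} [CommRing R] [IsDomain R]
    [UniqueFactorizationMonoid R] {p q : R[X]} (h : IsRelPrime p q) (h0 : p ≠ 0 ∨ q ≠ 0) :
    IsRelPrime (p.map (algebraMap R (FractionRing R))) (q.map (algebraMap R (FractionRing R))) := by
  classical
  have := Classical.arbitrary (NormalizedGCDMonoid R)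
  set K := FractionRing R
  intro d hdp hdq
  have hinj : Function.Injective (algebraMap R K) := IsFractionRing.injective _ _
  have hd0 : d ≠ 0 := by
    rintro rfl
    rw [zero_dvd_iff, Polynomial.map_eq_zero_iff hinj] at hdp hdq
    tauto
  obtain ⟨c, c0, hc⟩ := IsLocalization.integerNormalization_spec (nonZeroDivisors R) d
  set e := IsLocalization.integerNormalization (nonZeroDivisors R) d with he
  have hcK : algebraMap R K c ≠ 0 := by
    simpa using nonZeroDivisors.ne_zero c0
  have hmap : e.map (algebraMap R K) = Polynomial.C (algebraMap R K c) * d := by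
    rw [hc, Algebra.smul_def, Polynomial.algebraMap_apply]
  have he0 : e ≠ 0 := by
    intro h
    rw [h, Polynomial.map_zero] at hmap
    simp [hcK, hd0] at hmap
  have hct : algebraMap R K e.content ≠ 0 := by
    simpa [Polynomial.content_eq_zero_iff] using he0
  have hprim : Associated (e.primPart.map (algebraMap R K)) d := by
    have h1 : e.map (algebraMap R K) =
        Polynomial.C (algebraMap R K e.content) * e.primPart.map (algebraMap R K) := by
      conv_lhs => rw [e.eq_C_content_mul_primPart]
      simp
    have h2 := h1.symm.trans hmap
    have u1 : IsUnit (Polynomial.C (algebraMap R K e.content)) := Polynomial.isUnit_C.mpr (isUnit_iff_ne_zero.mpr hct)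
    have u2 : IsUnit (Polynomial.C (algebraMap R K c)) := Polynomial.isUnit_C.mpr (isUnit_iff_ne_zero.mpr hcK)
    exact ((associated_isUnit_mul_left_iff u1).mpr (Associated.refl _)).symm.trans
      ((Associated.of_eq h2).trans ((associated_isUnit_mul_left_iff u2).mpr (Associated.refl _)))
  have hu : IsUnit e.primPart :=
    h (e.isPrimitive_primPart.dvd_of_fraction_map_dvd_fraction_map (hprim.dvd.trans hdp))
      (e.isPrimitive_primPart.dvd_of_fraction_map_dvd_fraction_map (hprim.dvd.trans hdq))
  exact hprim.isUnit (hu.map (Polynomial.mapRingHom (algebraMap R K)))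

/-- The resultant is a combination of `p` and `q`, and it vanishes only if they have a common factor
over the fraction field. -/
theorem exists_C_mem_span_pair {R : Type*} [CommRing R] [IsDomain R]
    [UniqueFactorizationMonoid R] {p q : R[X]} (h : IsRelPrime p q) (h0 : p ≠ 0 ∨ q ≠ 0) :
    ∃ r : R, r ≠ 0 ∧ C r ∈ Ideal.span {p, q} := by
  by_cases hdeg : p.natDegree ≠ 0 ∨ q.natDegree ≠ 0
  · have hinj : Function.Injective (algebraMap R (FractionRing R)) := IsFractionRing.injective _ _
    obtain ⟨a, b, -, -, hab⟩ := exists_mul_add_mul_eq_C_resultant p q le_rfl le_rfl hdeg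
    refine ⟨_, fun h1 => ?_, Ideal.mem_span_pair.mpr ⟨a, b, by rw [← hab]; ring⟩⟩
    have h2 := resultant_map_map p q p.natDegree q.natDegree (algebraMap R (FractionRing R))
    rw [h1, map_zero] at h2
    rw [← natDegree_map_eq_of_injective hinj p, ← natDegree_map_eq_of_injective hinj q,
      resultant_eq_zero_iff] at h2
    exact h2.2 (isRelPrime_map_fractionRing h h0).isCoprime
  -- The resultant of two constants is an empty determinant, equal to 1, and need not lie in the
  -- ideal; a nonzero one of the two constants serves instead.
  · push Not at hdeg
    obtain ⟨hp, hq⟩ := hdeg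
    rw [eq_C_of_natDegree_eq_zero hp, eq_C_of_natDegree_eq_zero hq] at h0 ⊢
    rcases h0 with h0 | h0
    · exact ⟨p.coeff 0, fun h => h0 (by rw [h, C_0]), Ideal.subset_span (by simp)⟩
    · exact ⟨q.coeff 0, fun h => h0 (by rw [h, C_0]), Ideal.subset_span (by simp)⟩

end Resultant

/-! ### Weighted grading encoded by an auxiliary variable -/

section WeightGenerating

open MvPolynomial

variable {σ : Type*} (w : σ → ℕ)

/-- The polynomial whose coefficients are the weighted homogeneous components. -/
def weightExpand : MvPolynomial σ ℂ →ₐ[ℂ] Polynomial (MvPolynomial σ ℂ) :=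
  aeval fun i => Polynomial.C (X i) * Polynomial.X ^ w i

theorem weightExpand_monomial (m : σ →₀ ℕ) (c : ℂ) :
    weightExpand w (monomial m c) = Polynomial.monomial (Finsupp.weight w m) (monomial m c) := by
  have h : ∀ s : Finset σ, ∏ i ∈ s, (Polynomial.C (X i : MvPolynomial σ ℂ) *
      Polynomial.X ^ w i) ^ m i =
      Polynomial.C (∏ i ∈ s, X i ^ m i) * Polynomial.X ^ ∑ i ∈ s, m i * w i := by
    intro s
    induction s using Finset.cons_induction with
    | empty => simp
    | cons i s hi ih =>
      rw [Finset.prod_cons, Finset.prod_cons, Finset.sum_cons, ih, Polynomial.C_mul,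
        Polynomial.C_pow]
      ring
  have e : algebraMap ℂ (Polynomial (MvPolynomial σ ℂ)) c = Polynomial.C (C c) := rfl
  rw [weightExpand, aeval_monomial, ← Polynomial.C_mul_X_pow_eq_monomial, monomial_eq,
    Finsupp.weight_apply, Finsupp.prod, h, Polynomial.C_mul, Finsupp.prod, Finsupp.sum, e,
    mul_assoc]
  simp only [smul_eq_mul]

theorem coeff_weightExpand (p : MvPolynomial σ ℂ) (j : ℕ) :
    (weightExpand w p).coeff j = weightedHomogeneousComponent w j p := by
  induction p using MvPolynomial.induction_on' with
  | monomial m c =>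
    rw [weightExpand_monomial, Polynomial.coeff_monomial]
    split_ifs with h
    · exact ((isWeightedHomogeneous_monomial w m c h).weightedHomogeneousComponent_same).symm
    · exact ((isWeightedHomogeneous_monomial w m c rfl).weightedHomogeneousComponent_ne j (Ne.symm h)).symm
  | add p q hp hq => simp [hp, hq]

theorem weightExpand_eq_of_isWeightedHomogeneous {p : MvPolynomial σ ℂ} {k : ℕ}
    (hp : p.IsWeightedHomogeneous w k) : weightExpand w p = Polynomial.monomial k p := by
  ext1 j
  rw [coeff_weightExpand, Polynomial.coeff_monomial]
  split_ifs with h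
  · rw [← h, hp.weightedHomogeneousComponent_same]
  · rw [hp.weightedHomogeneousComponent_ne j (Ne.symm h)]

variable {w}

/-- The expansion of `f` is a monomial in the auxiliary variable. Top and trailing degrees add in
products, so they agree for each factor; a nonzero constant term makes both 0 for `p`. -/
theorem isUnit_of_dvd_of_isWeightedHomogeneous (hw : ∀ i, w i ≠ 0) {f p : MvPolynomial σ ℂ}
    {k : ℕ} (hf : f.IsWeightedHomogeneous w k) (hf0 : f ≠ 0) (hp : p ∣ f)
    (hc : constantCoeff p ≠ 0) : IsUnit p := by
  obtain ⟨q, rfl⟩ := hp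
  have h := weightExpand_eq_of_isWeightedHomogeneous w hf
  have hz : (weightExpand w p).coeff 0 = C (constantCoeff p) := by
    rw [coeff_weightExpand, weightedHomogeneousComponent_zero _ (by simpa using hw),
      constantCoeff_eq]
  have hne : (weightExpand w p) * weightExpand w q ≠ 0 := by
    rw [← map_mul, h]
    simpa using hf0
  rw [map_mul] at h
  have hp0 := left_ne_zero_of_mul hne
  have hq0 := right_ne_zero_of_mul hne
  have h1 : (weightExpand w p).natDegree + (weightExpand w q).natDegree = k := by
    rw [← Polynomial.natDegree_mul hp0 hq0, h, Polynomial.natDegree_monomial_eq _ hf0]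
  have h2 : (weightExpand w p).natTrailingDegree + (weightExpand w q).natTrailingDegree = k := by
    rw [← Polynomial.natTrailingDegree_mul hp0 hq0, h, Polynomial.natTrailingDegree_monomial hf0]
  have h3 : (weightExpand w p).natTrailingDegree = 0 := by
    rw [Polynomial.natTrailingDegree_eq_zero]
    right
    rw [hz]
    simpa using hc
  have h4 := Polynomial.natTrailingDegree_le_natDegree (weightExpand w q)
  have h5 : (weightExpand w p).natDegree = 0 := by omega
  have h6 : p = C (constantCoeff p) := by
    conv_lhs => rw [← finsum_weightedHomogeneousComponent w p]
    rw [← hz, coeff_weightExpand, finsum_eq_single _ 0]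
    intro j hj
    rw [← coeff_weightExpand]
    exact Polynomial.coeff_eq_zero_of_natDegree_lt (by omega)
  rw [h6]
  exact (isUnit_iff_ne_zero.mpr hc).map C

end WeightGenerating

/-! ### The Jacobian ideal of a reduced weighted homogeneous polynomial -/

section JacobianIdeal

open MvPolynomial

theorem weightedHomogeneousComponent_mul_of_isWeightedHomogeneous {σ : Type*} {w : σ → ℕ}
    {g : MvPolynomial σ ℂ} {e : ℕ} (hg : g.IsWeightedHomogeneous w e) (a : MvPolynomial σ ℂ)
    (j : ℕ) : weightedHomogeneousComponent w j (a * g) =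
      if e ≤ j then weightedHomogeneousComponent w (j - e) a * g else 0 := by
  rw [← coeff_weightExpand, map_mul, weightExpand_eq_of_isWeightedHomogeneous w hg,
    ← Polynomial.C_mul_X_pow_eq_monomial, ← mul_assoc, Polynomial.coeff_mul_X_pow']
  split_ifs
  · rw [Polynomial.coeff_mul_C, coeff_weightExpand]
  · rfl

theorem exists_isWeightedHomogeneous_pderiv {σ : Type*} {w : σ → ℕ} {f : MvPolynomial σ ℂ} {k : ℕ}
    (hf : f.IsWeightedHomogeneous w k) (i : σ) :
    ∃ e, (pderiv i f).IsWeightedHomogeneous w e := by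
  by_cases h : w i ≤ k
  · exact ⟨k - w i, hf.pderiv (by omega)⟩
  -- The variable is too heavy to occur in `f`, so the derivative is zero and any degree will do.
  · refine ⟨0, fun m hm => absurd ?_ h⟩
    rw [coeff_pderiv] at hm
    have := hf (left_ne_zero_of_mul hm)
    rw [map_add, Finsupp.weight_single] at this
    simp only [one_smul] at this
    omega

theorem totalDegree_lt_of_pderiv_ne_zero {σ : Type*} {p : MvPolynomial σ ℂ} {i : σ}
    (h : pderiv i p ≠ 0) : (pderiv i p).totalDegree < p.totalDegree := by
  obtain ⟨m, hm, hd⟩ := Finset.exists_mem_eq_sup _ (support_nonempty.mpr h)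
    fun s => s.sum fun _ e => e
  rw [mem_support_iff, coeff_pderiv] at hm
  have := le_totalDegree (mem_support_iff.mpr (left_ne_zero_of_mul hm))
  rw [totalDegree, hd]
  rw [Finsupp.sum_add_index' (by simp) (by simp), Finsupp.sum_single_index rfl] at this
  omega

theorem eq_C_of_pderiv_eq_zero {σ : Type*} {p : MvPolynomial σ ℂ} (h : ∀ i, pderiv i p = 0) :
    p = C (constantCoeff p) := by
  classical
  ext m
  rw [coeff_C]
  split_ifs with hm
  · rw [← hm, constantCoeff_eq]
  · obtain ⟨i, hi⟩ := Finsupp.ne_iff.mp (Ne.symm hm)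
    have h1 := coeff_pderiv (i := i) p (m - Finsupp.single i 1)
    rw [h i, coeff_zero, tsub_add_cancel_of_le (by simpa [Nat.one_le_iff_ne_zero] using hi)] at h1
    exact (mul_eq_zero.mp h1.symm).resolve_right (Nat.cast_add_one_ne_zero _)

variable {w : Fin 2 → ℕ} {k : ℕ} {f : MvPolynomial (Fin 2) ℂ}

theorem mem_jacobianIdeal_iff {f p : MvPolynomial (Fin 2) ℂ} :
    p ∈ jacobianIdeal f ↔ ∃ a b, a * pderiv 0 f + b * pderiv 1 f = p := by
  have : Set.range (fun i => pderiv i f) = {pderiv 0 f, pderiv 1 f} := by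
    ext; simp [Fin.exists_fin_two, eq_comm]
  rw [jacobianIdeal, this, Ideal.mem_span_pair]

theorem euler_two (hf : f.IsWeightedHomogeneous w k) :
    ((w 0 : ℕ) : MvPolynomial (Fin 2) ℂ) * (X 0 * pderiv 0 f) +
      ((w 1 : ℕ) : MvPolynomial (Fin 2) ℂ) * (X 1 * pderiv 1 f) =
      (k : MvPolynomial (Fin 2) ℂ) * f := by
  simpa using hf.sum_weight_X_mul_pderiv

theorem ne_zero_of_constantCoeff_eq_zero (hf : f.IsWeightedHomogeneous w k) (h0 : f ≠ 0)
    (hf0 : constantCoeff f = 0) (hw : ∀ i, w i ≠ 0) : k ≠ 0 := by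
  rintro rfl
  apply h0
  rw [← hf.weightedHomogeneousComponent_same,
    weightedHomogeneousComponent_zero _ (by simpa using hw), ← constantCoeff_eq, hf0, C_0]

/-- By Euler's relation a common irreducible factor `p` divides `f = p q`, and it vanishes at the
origin because `f` is weighted homogeneous. Reducedness at the origin gives `p ∤ q`, so `p` divides
its own derivatives; by degree these vanish and `p` is constant, hence 0. -/
theorem isRelPrime_pderiv (hw : ∀ i, w i ≠ 0) (hf : f.IsWeightedHomogeneous w k) (h0 : f ≠ 0)
    (hk : k ≠ 0) (hsq : ∀ p, p * p ∣ f → constantCoeff p ≠ 0) :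
    IsRelPrime (pderiv 0 f) (pderiv 1 f) := by
  have hk' : IsUnit (k : MvPolynomial (Fin 2) ℂ) := by
    rw [← map_natCast C]
    exact (isUnit_iff_ne_zero.mpr (Nat.cast_ne_zero.mpr hk)).map C
  intro d hd0 hd1
  by_contra hu
  have hdf : d ∣ f := by
    rw [← hk'.dvd_mul_left, ← euler_two hf]
    exact dvd_add ((hd0.mul_left _).mul_left _) ((hd1.mul_left _).mul_left _)
  obtain ⟨p, hp, hpd⟩ := WfDvdMonoid.exists_irreducible_factor hu (ne_zero_of_dvd_ne_zero h0 hdf)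
  have hpf := hpd.trans hdf
  have hdvd : ∀ i, p ∣ pderiv i f := by
    rw [Fin.forall_fin_two]
    exact ⟨hpd.trans hd0, hpd.trans hd1⟩
  have hc : constantCoeff p = 0 := by
    by_contra hc
    exact hp.not_isUnit (isUnit_of_dvd_of_isWeightedHomogeneous hw hf h0 hpf hc)
  obtain ⟨q, rfl⟩ := hpf
  have hq : ¬ p ∣ q := fun h => hsq p (mul_dvd_mul_left p h) hc
  have hpi : ∀ i, p ∣ pderiv i p := fun i => by
    have := hdvd i
    rw [pderiv_mul, dvd_add_left (dvd_mul_right p _)] at this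
    exact (hp.prime.dvd_or_dvd this).resolve_right hq
  have hz : ∀ i, pderiv i p = 0 := fun i => by
    by_contra hne
    obtain ⟨c, hc⟩ := hpi i
    have h1 := totalDegree_lt_of_pderiv_ne_zero hne
    rw [hc] at hne h1
    rw [totalDegree_mul_of_isDomain (left_ne_zero_of_mul hne) (right_ne_zero_of_mul hne)] at h1
    omega
  exact hp.ne_zero (by rw [eq_C_of_pderiv_eq_zero hz, hc, C_0])

theorem finSuccEquiv_rename_succ {n : ℕ} (r : MvPolynomial (Fin n) ℂ) :
    finSuccEquiv ℂ n (rename Fin.succ r) = Polynomial.C r := by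
  induction r using MvPolynomial.induction_on with
  | C c => simp [finSuccEquiv_apply]
  | add p q hp hq => simp [hp, hq]
  | mul_X p i hp => simp [hp, finSuccEquiv_X_succ]

/-- Elimination of the other variable: after a swap, `X i` is the one left in the coefficient ring
of `finSuccEquiv`. -/
theorem exists_rename_mem_span_pair {p q : MvPolynomial (Fin 2) ℂ} (h : IsRelPrime p q)
    (h0 : p ≠ 0 ∨ q ≠ 0) (i : Fin 2) : ∃ r : MvPolynomial (Fin 1) ℂ, r ≠ 0 ∧
      rename (fun _ => i) r ∈ Ideal.span {p, q} := by
  let e : MvPolynomial (Fin 2) ℂ ≃ₐ[ℂ] Polynomial (MvPolynomial (Fin 1) ℂ) :=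
    (renameEquiv ℂ (Equiv.swap 1 i)).trans (finSuccEquiv ℂ 1)
  have he : ∀ r, e (rename (fun _ => i) r) = Polynomial.C r := fun r => by
    rw [← finSuccEquiv_rename_succ]
    simp only [e, AlgEquiv.trans_apply, renameEquiv_apply, rename_rename]
    congr 3
    funext j
    fin_cases j
    simp
  have hrel : IsRelPrime (e p) (e q) := fun d hp hq => by
    have := h (d := e.symm d) (by simpa using map_dvd e.symm hp) (by simpa using map_dvd e.symm hq)
    simpa using this.map e
  obtain ⟨r, hr, hm⟩ := exists_C_mem_span_pair hrel (by simpa using h0)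
  refine ⟨r, hr, ?_⟩
  rw [← he, Ideal.mem_span_pair] at hm
  obtain ⟨a, b, hab⟩ := hm
  refine Ideal.mem_span_pair.mpr ⟨e.symm a, e.symm b, e.injective ?_⟩
  rw [← hab]
  simp

theorem isHomogeneous_jacobianIdeal (hf : f.IsWeightedHomogeneous w k) {p : MvPolynomial (Fin 2) ℂ}
    (hp : p ∈ jacobianIdeal f) (m : ℕ) : weightedHomogeneousComponent w m p ∈ jacobianIdeal f := by
  obtain ⟨a, b, rfl⟩ := mem_jacobianIdeal_iff.mp hp
  have key : ∀ i a, weightedHomogeneousComponent w m (a * pderiv i f) ∈ jacobianIdeal f := by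
    intro i a
    obtain ⟨e, he⟩ := exists_isWeightedHomogeneous_pderiv hf i
    rw [weightedHomogeneousComponent_mul_of_isWeightedHomogeneous he]
    split_ifs
    · exact Ideal.mul_mem_left _ _ (Ideal.subset_span ⟨i, rfl⟩)
    · exact zero_mem _
  rw [map_add]
  exact add_mem (key 0 a) (key 1 b)

/-- Distinct powers of `X i` have distinct weights, so a weighted component of an eliminated
polynomial is a single monomial, and it stays in the homogeneous ideal. -/
theorem exists_X_pow_mem_jacobianIdeal (hw : ∀ i, w i ≠ 0) (hf : f.IsWeightedHomogeneous w k)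
    (hrel : IsRelPrime (pderiv 0 f) (pderiv 1 f)) (h0 : pderiv 0 f ≠ 0 ∨ pderiv 1 f ≠ 0)
    (i : Fin 2) : ∃ N, (X i : MvPolynomial (Fin 2) ℂ) ^ N ∈ jacobianIdeal f := by
  classical
  obtain ⟨r, hr, hm⟩ := exists_rename_mem_span_pair hrel h0 i
  have hm' : rename (fun _ => i) r ∈ jacobianIdeal f :=
    mem_jacobianIdeal_iff.mpr (Ideal.mem_span_pair.mp hm)
  obtain ⟨m, hm⟩ := support_nonempty.mpr hr
  rw [mem_support_iff] at hm
  have hinj : Function.Injective (fun _ : Fin 1 => i) := Function.injective_of_subsingleton _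
  have hcomp := isHomogeneous_jacobianIdeal hf hm' (w i * m 0)
  have : weightedHomogeneousComponent w (w i * m 0) (rename (fun _ => i) r) =
      C (coeff m r) * X i ^ m 0 := by
    ext s
    rw [coeff_weightedHomogeneousComponent, coeff_C_mul, coeff_X_pow]
    have hms : Finsupp.single i (m 0) = m.mapDomain (fun _ => i) := by
      conv_rhs => rw [Finsupp.unique_single m]
      rw [Finsupp.mapDomain_single]
      rfl
    split_ifs with h1 h2 h2
    · rw [← h2, hms, coeff_rename_mapDomain _ hinj, mul_one]
    · rw [mul_zero]
      refine coeff_rename_eq_zero _ _ _ fun u hu => ?_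
      exfalso
      rw [Finsupp.unique_single u, Finsupp.mapDomain_single] at hu
      rw [← hu, Finsupp.weight_single, smul_eq_mul, mul_comm] at h1
      have := Nat.eq_of_mul_eq_mul_left (Nat.pos_of_ne_zero (hw i)) h1
      exact h2 (by rw [← hu, ← this])
    · exact absurd (by rw [← h2, Finsupp.weight_single, smul_eq_mul, mul_comm]) h1
    · rw [mul_zero]
  rw [this] at hcomp
  refine ⟨m 0, ?_⟩
  have h2 := Ideal.mul_mem_left _ (C (coeff m r)⁻¹) hcomp
  rwa [← mul_assoc, ← C_mul, inv_mul_cancel₀ hm, C_1, one_mul] at h2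

end JacobianIdeal

/-! ### Dimension count in the homogeneous case -/

section Dimension

open MvPolynomial

instance finite_weightedHomogeneousSubmodule_one (d : ℕ) :
    Module.Finite ℂ (weightedHomogeneousSubmodule ℂ (1 : Fin 2 → ℕ) d) :=
  Module.Finite.iff_fg.mpr (weightedHomogeneousSubmodule_fg _ _ (by simp) d)

theorem finrank_weightedHomogeneousSubmodule_one (d : ℕ) :
    Module.finrank ℂ (weightedHomogeneousSubmodule ℂ (1 : Fin 2 → ℕ) d) = d + 1 := by
  have e : weightedHomogeneousSubmodule ℂ (1 : Fin 2 → ℕ) d =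
      restrictSupport ℂ {m | Finsupp.weight (1 : Fin 2 → ℕ) m = d} :=
    weightedHomogeneousSubmodule_eq_finsupp_supported _ _ _
  have h : ∀ m : Fin 2 →₀ ℕ, Finsupp.weight (1 : Fin 2 → ℕ) m = m 0 + m 1 := fun m => by
    simp [Finsupp.weight_apply, Finsupp.sum_fintype]
  let E : {m | Finsupp.weight (1 : Fin 2 → ℕ) m = d} ≃ Finset.HasAntidiagonal.antidiagonal d :=
    { toFun m := ⟨(m.1 0, m.1 1), by
        rw [Finset.HasAntidiagonal.mem_antidiagonal, ← h]; exact m.2⟩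
      invFun p := ⟨Finsupp.equivFunOnFinite.symm ![p.1.1, p.1.2], by
        rw [Set.mem_ofPred, h]
        simpa using Finset.HasAntidiagonal.mem_antidiagonal.mp p.2⟩
      left_inv m := by
        ext i
        fin_cases i <;> rfl
      right_inv p := rfl }
  rw [e, Module.finrank_eq_nat_card_basis (basisRestrictSupport ℂ _), Nat.card_congr E,
    Nat.card_eq_fintype_card, Fintype.card_coe, Finset.Nat.card_antidiagonal]

variable {f : MvPolynomial (Fin 2) ℂ} {d : ℕ}

/-- The pairs of linear forms, mapped to the degree `d` part of the Jacobian ideal. -/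
def linearCombinationPDeriv (hf : f.IsHomogeneous (d + 1)) :
    weightedHomogeneousSubmodule ℂ (1 : Fin 2 → ℕ) 1 ×
      weightedHomogeneousSubmodule ℂ (1 : Fin 2 → ℕ) 1 →ₗ[ℂ]
      weightedHomogeneousSubmodule ℂ (1 : Fin 2 → ℕ) (d + 1) where
  toFun l := ⟨l.1.1 * pderiv 0 f + l.2.1 * pderiv 1 f, by
    have h : ∀ i, (pderiv i f).IsWeightedHomogeneous 1 d := fun i => hf.pderiv
    rw [add_comm d]
    exact add_mem (IsWeightedHomogeneous.mul l.1.2 (h 0)) (IsWeightedHomogeneous.mul l.2.2 (h 1))⟩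
  map_add' l m := Subtype.ext (by
    change (l.1.1 + m.1.1) * _ + (l.2.1 + m.2.1) * _ =
      (l.1.1 * _ + l.2.1 * _) + (m.1.1 * _ + m.2.1 * _)
    ring)
  map_smul' c l := Subtype.ext (by
    change (c • l.1.1) * _ + (c • l.2.1) * _ = c • (l.1.1 * _ + l.2.1 * _)
    simp only [smul_add, smul_mul_assoc])

/-- The derivatives have degree `d`, so only the linear parts of the two coefficients contribute in
degree `d + 1`. -/
theorem range_linearCombinationPDeriv (hf : f.IsHomogeneous (d + 1)) :
    LinearMap.range (linearCombinationPDeriv hf) =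
      ((jacobianIdeal f).restrictScalars ℂ).submoduleOf
        (weightedHomogeneousSubmodule ℂ (1 : Fin 2 → ℕ) (d + 1)) := by
  have h : ∀ i, (pderiv i f).IsWeightedHomogeneous 1 d := fun i => hf.pderiv
  ext p
  rw [Submodule.submoduleOf, Submodule.mem_comap, Submodule.subtype_apply,
    Submodule.restrictScalars_mem, mem_jacobianIdeal_iff]
  constructor
  · rintro ⟨l, rfl⟩
    exact ⟨_, _, rfl⟩
  · rintro ⟨a, b, hab⟩
    refine ⟨(⟨_, weightedHomogeneousComponent_mem 1 a 1⟩,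
      ⟨_, weightedHomogeneousComponent_mem 1 b 1⟩), Subtype.ext ?_⟩
    have := congrArg (weightedHomogeneousComponent (1 : Fin 2 → ℕ) (d + 1)) hab
    rw [map_add, weightedHomogeneousComponent_mul_of_isWeightedHomogeneous (h 0),
      weightedHomogeneousComponent_mul_of_isWeightedHomogeneous (h 1), if_pos (by omega),
      if_pos (by omega), IsWeightedHomogeneous.weightedHomogeneousComponent_same p.2,
      Nat.add_sub_cancel_left] at this
    exact this

theorem eq_zero_of_dvd_of_isWeightedHomogeneous {σ : Type*} {w : σ → ℕ} {g l : MvPolynomial σ ℂ}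
    {d e : ℕ} (hg : g.IsWeightedHomogeneous w d) (hl : l.IsWeightedHomogeneous w e) (h : g ∣ l)
    (hde : e < d) : l = 0 := by
  obtain ⟨c, rfl⟩ := h
  rw [← hl.weightedHomogeneousComponent_same, mul_comm,
    weightedHomogeneousComponent_mul_of_isWeightedHomogeneous hg, if_neg (by omega)]

/-- A syzygy of linear forms is divisible by the opposite derivatives, of degree `d`. For `d > 1`
there is none and 4 dimensions are removed; for `d = 1` the syzygies form at most a line, so all 3
dimensions are removed; for `d = 0` the Jacobian ideal is everything. -/
theorem finrank_jacobianQuotient (hf : f.IsHomogeneous (d + 1))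
    (hrel : IsRelPrime (pderiv 0 f) (pderiv 1 f)) :
    Module.finrank ℂ (JacobianQuotient (1 : Fin 2 → ℕ) (d + 1) f) = d + 1 - 3 := by
  have h : ∀ i, (pderiv i f).IsWeightedHomogeneous 1 d := fun i => hf.pderiv
  have hq := Submodule.finrank_quotient_add_finrank
    (((jacobianIdeal f).restrictScalars ℂ).submoduleOf
        (weightedHomogeneousSubmodule ℂ (1 : Fin 2 → ℕ) (d + 1)))
  rw [finrank_weightedHomogeneousSubmodule_one] at hq
  have hr := (linearCombinationPDeriv hf).finrank_range_add_finrank_ker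
  rw [range_linearCombinationPDeriv, Module.finrank_prod,
    finrank_weightedHomogeneousSubmodule_one] at hr
  have hdvd : ∀ l ∈ LinearMap.ker (linearCombinationPDeriv hf),
      pderiv 1 f ∣ l.1.1 ∧ pderiv 0 f ∣ l.2.1 := by
    intro l hl
    have hl' : l.1.1 * pderiv 0 f + l.2.1 * pderiv 1 f = 0 := congrArg Subtype.val hl
    constructor
    · refine hrel.symm.dvd_of_dvd_mul_right ⟨-l.2.1, ?_⟩
      linear_combination hl'
    · refine hrel.dvd_of_dvd_mul_right ⟨-l.1.1, ?_⟩
      linear_combination hl'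
  change Module.finrank ℂ (_ ⧸ _) = _
  rcases Nat.lt_or_ge 1 d with hd | hd
  · have : LinearMap.ker (linearCombinationPDeriv hf) = ⊥ := by
      rw [eq_bot_iff]
      intro l hl
      obtain ⟨h1, h0⟩ := hdvd l hl
      exact Prod.ext
        (Subtype.ext (eq_zero_of_dvd_of_isWeightedHomogeneous (h 1) l.1.2 h1 hd))
        (Subtype.ext (eq_zero_of_dvd_of_isWeightedHomogeneous (h 0) l.2.2 h0 hd))
    rw [this, finrank_bot] at hr
    omega
  have hunit : ∀ i, d = 1 → ¬ IsUnit (pderiv i f) := by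
    rintro i rfl hu
    have h1 := hu.map (constantCoeff (R := ℂ) (σ := Fin 2))
    have : constantCoeff (pderiv i f) = 0 := by
      by_contra hne
      have := h i hne
      simp at this
    exact h1.ne_zero this
  interval_cases d
  · have hC : ∀ i, pderiv i f = C (coeff 0 (pderiv i f)) := fun i => by
      rw [← weightedHomogeneousComponent_zero (w := (1 : Fin 2 → ℕ)) _ (by simp),
        (h i).weightedHomogeneousComponent_same]
    have hex : ∃ i, coeff 0 (pderiv i f) ≠ 0 := by
      by_contra! h0
      rw [hC 0, hC 1, h0, h0, C_0] at hrel
      exact not_isUnit_zero (isRelPrime_zero_left.mp hrel)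
    obtain ⟨i, hi⟩ := hex
    have htop : jacobianIdeal f = ⊤ :=
      Ideal.eq_top_of_isUnit_mem _ (Ideal.subset_span ⟨i, rfl⟩)
        (by beta_reduce; rw [hC i]; exact (isUnit_iff_ne_zero.mpr hi).map C)
    have : Subsingleton (weightedHomogeneousSubmodule ℂ (1 : Fin 2 → ℕ) (0 + 1) ⧸
        ((jacobianIdeal f).restrictScalars ℂ).submoduleOf
          (weightedHomogeneousSubmodule ℂ (1 : Fin 2 → ℕ) (0 + 1))) := by
      rw [Submodule.Quotient.subsingleton_iff, htop]
      rfl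
    rw [Module.finrank_zero_of_subsingleton]
  · have : Module.finrank ℂ (LinearMap.ker (linearCombinationPDeriv hf)) ≤ 1 := by
      have hne : ∀ i, pderiv i f ≠ 0 := by
        rw [Fin.forall_fin_two]
        constructor
        · intro h0
          exact hunit 1 rfl (isRelPrime_zero_left.mp (h0 ▸ hrel))
        · intro h0
          exact hunit 0 rfl (isRelPrime_zero_right.mp (h0 ▸ hrel))
      -- The Koszul relation spans the kernel.
      refine finrank_le_one ⟨(⟨pderiv 1 f, h 1⟩, -⟨pderiv 0 f, h 0⟩), ?_⟩ ?_
      · refine Subtype.ext ?_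
        change pderiv 1 f * pderiv 0 f + -pderiv 0 f * pderiv 1 f = 0
        ring
      · rintro ⟨l, hl⟩
        obtain ⟨⟨c, hc⟩, -⟩ := hdvd l hl
        have h3 : l.1.1 = C (coeff 0 c) * pderiv 1 f := by
          have := IsWeightedHomogeneous.weightedHomogeneousComponent_same l.1.2
          rw [hc, mul_comm, weightedHomogeneousComponent_mul_of_isWeightedHomogeneous (h 1),
            if_pos le_rfl, Nat.sub_self, weightedHomogeneousComponent_zero _ (by simp)] at this
          rw [hc, mul_comm, this]
        have hl' : l.1.1 * pderiv 0 f + l.2.1 * pderiv 1 f = 0 := congrArg Subtype.val hl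
        have h4 : l.2.1 = - (C (coeff 0 c) * pderiv 0 f) := by
          apply mul_right_cancel₀ (hne 1)
          rw [h3] at hl'
          linear_combination hl'
        refine ⟨coeff 0 c, Subtype.ext (Prod.ext (Subtype.ext ?_) (Subtype.ext ?_))⟩
        · rw [h3, C_mul']
          rfl
        · rw [h4, C_mul', ← smul_neg]
          rfl
    omega

end Dimension

/-! ### Convergent power series and their comparison with polynomials -/

section Germs

variable {n : ℕ}

theorem IsConvergent.of_norm_coeff_le {f g : MvPowerSeries (Fin n) ℂ} (hg : IsConvergent g)
    (h : ∀ a, ‖MvPowerSeries.coeff a f‖ ≤ ‖MvPowerSeries.coeff a g‖) : IsConvergent f := by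
  obtain ⟨r, hr, hg⟩ := hg
  exact ⟨r, hr, Summable.of_nonneg_of_le (fun _ => by positivity)
    (fun a => mul_le_mul_of_nonneg_right (h a) (by positivity)) hg⟩

theorem IsConvergent.of_coeff_eq_add {f g : MvPowerSeries (Fin n) ℂ} (hg : IsConvergent g)
    (s : Fin n →₀ ℕ) (h : ∀ a, MvPowerSeries.coeff a f = MvPowerSeries.coeff (a + s) g) :
    IsConvergent f := by
  obtain ⟨r, hr, hg⟩ := hg
  have h1 := (hg.comp_injective (add_left_injective s)).mul_left (r ^ s.degree)⁻¹
  refine ⟨r, hr, h1.congr fun a => ?_⟩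
  have : r ^ s.degree ≠ 0 := by positivity
  simp only [Function.comp_apply, h, map_add, pow_add]
  field_simp

theorem isConvergent_pderiv {g : MvPowerSeries (Fin n) ℂ} (hg : IsConvergent g) (i : Fin n) :
    IsConvergent (MvPowerSeries.pderiv ℂ i g) := by
  obtain ⟨r, hr, h⟩ := hg
  have h1 := (h.comp_injective (add_left_injective (Finsupp.single i 1))).mul_left r⁻¹
  -- Halving the radius gains a factor `2 ^ |a|`, which absorbs the factor `a i + 1` produced by
  -- differentiation.
  refine ⟨r / 2, by positivity, Summable.of_nonneg_of_le (fun _ => by positivity)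
    (fun a => ?_) h1⟩
  have h2 : ((a i : ℝ) + 1) ≤ 2 ^ a.degree := by
    have h3 : a i ≤ a.degree := Finsupp.le_degree i a
    have h4 : a.degree < 2 ^ a.degree := Nat.lt_two_pow_self
    have h5 : a i + 1 ≤ 2 ^ a.degree := by omega
    exact_mod_cast h5
  have h6 : ‖((a i : ℂ) + 1)‖ = (a i : ℝ) + 1 := by
    rw [← Nat.cast_add_one, ← Nat.cast_add_one, Complex.norm_natCast]
  rw [MvPowerSeries.coeff_pderiv, norm_mul, h6, div_pow]
  simp only [Function.comp_apply, map_add, pow_add, Finsupp.degree_single, pow_one]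
  set c := ‖MvPowerSeries.coeff (a + Finsupp.single i 1) g‖
  calc c * (a i + 1) * (r ^ a.degree / 2 ^ a.degree)
      ≤ c * 2 ^ a.degree * (r ^ a.degree / 2 ^ a.degree) := by gcongr
    _ = r⁻¹ * (c * (r ^ a.degree * r)) := by field_simp

/-- The partial derivative with respect to the `i`-th coordinate. -/
def pderivGerm (i : Fin n) : Derivation ℂ (HolGerm n) (HolGerm n) :=
  Derivation.mk'
    { toFun g := ⟨MvPowerSeries.pderiv ℂ i g.1, isConvergent_pderiv g.2 i⟩
      map_add' g h := Subtype.ext (map_add (MvPowerSeries.pderiv ℂ i) g.1 h.1)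
      map_smul' c g := Subtype.ext ((MvPowerSeries.pderiv ℂ i).map_smul c g.1) }
    fun g h => Subtype.ext ((MvPowerSeries.pderiv ℂ i).leibniz g.1 h.1)

theorem pderivGerm_coord [DecidableEq (Fin n)] (i j : Fin n) :
    pderivGerm i (coord j) = Pi.single (M := fun _ => HolGerm n) i 1 j := by
  refine Subtype.ext ((MvPowerSeries.pderiv_X i j).trans ?_)
  rcases eq_or_ne j i with rfl | h
  · simp
  · simp [h]

theorem derivation_polyGerm (θ : Derivation ℂ (HolGerm n) (HolGerm n))
    (p : MvPolynomial (Fin n) ℂ) :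
    θ (polyGerm n p) = ∑ i, θ (coord i) * polyGerm n (MvPolynomial.pderiv i p) := by
  classical
  induction p using MvPolynomial.induction_on with
  | C c =>
    rw [← MvPolynomial.algebraMap_eq, AlgHom.commutes]
    simp
  | add p q hp hq => simp [hp, hq, mul_add, Finset.sum_add_distrib]
  | mul_X p j hp =>
    have hj : polyGerm n (MvPolynomial.X j) = coord j := by simp [polyGerm]
    have h1 : ∀ i, polyGerm n (MvPolynomial.pderiv i (p * MvPolynomial.X j)) =
        polyGerm n (MvPolynomial.pderiv i p) * coord j +
          polyGerm n p * (if j = i then 1 else 0) := fun i => by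
      rw [MvPolynomial.pderiv_mul, map_add, map_mul, map_mul, hj, MvPolynomial.pderiv_X]
      congr 2
      rcases eq_or_ne j i with rfl | h <;> simp [*]
    have h2 : ∑ i, θ (coord i) * (polyGerm n p * (if j = i then 1 else 0)) =
        polyGerm n p * θ (coord j) := by
      simp [mul_comm]
    rw [Finset.sum_congr rfl fun i _ => congrArg (θ (coord i) * ·) (h1 i)]
    simp only [mul_add, Finset.sum_add_distrib, h2]
    rw [map_mul, hj, Derivation.leibniz, hp, smul_eq_mul, smul_eq_mul, add_comm, Finset.mul_sum]
    congr 1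
    exact Finset.sum_congr rfl fun i _ => by ring

theorem coe_polyGerm (p : MvPolynomial (Fin n) ℂ) : (polyGerm n p).1 = (p : MvPowerSeries _ ℂ) := by
  have : (convergent n).val.comp (polyGerm n) =
      MvPolynomial.coeToMvPowerSeries.algHom (σ := Fin n) (R := ℂ) ℂ := by
    ext i
    simp [polyGerm, coord]
  have := congrArg (fun φ => φ p) this
  simpa using this

/-- The formal quotient has the same coefficients with shifted exponents, so it converges. -/
theorem coord_pow_dvd {i : Fin n} {N : ℕ} {g : HolGerm n}
    (h : ∀ m : Fin n →₀ ℕ, m i < N → MvPowerSeries.coeff m g.1 = 0) : coord i ^ N ∣ g := by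
  obtain ⟨φ, hφ⟩ := MvPowerSeries.X_pow_dvd_iff.mpr h
  have hc : IsConvergent φ := by
    refine g.2.of_coeff_eq_add (Finsupp.single i N) fun a => ?_
    rw [hφ, MvPowerSeries.X_pow_eq, add_comm, MvPowerSeries.coeff_add_monomial_mul, one_mul]
  exact ⟨⟨φ, hc⟩, Subtype.ext hφ⟩

theorem coeff_eq_zero_of_coord_pow_dvd {i : Fin n} {N : ℕ} {g : HolGerm n} (h : coord i ^ N ∣ g)
    {m : Fin n →₀ ℕ} (hm : m i < N) : MvPowerSeries.coeff m g.1 = 0 := by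
  obtain ⟨φ, rfl⟩ := h
  exact MvPowerSeries.X_pow_dvd_iff.mp ⟨φ.1, rfl⟩ m hm

open Classical in
/-- The sum of the terms of `g` whose exponents satisfy `P`. -/
def filterGerm (P : (Fin n →₀ ℕ) → Prop) (g : HolGerm n) : HolGerm n :=
  ⟨fun a => if P a then MvPowerSeries.coeff a g.1 else 0, g.2.of_norm_coeff_le fun a => by
    change ‖if P a then MvPowerSeries.coeff a g.1 else 0‖ ≤ _
    split_ifs <;> simp⟩

open Classical in
theorem coeff_filterGerm (P : (Fin n →₀ ℕ) → Prop)
    (g : HolGerm n) (a : Fin n →₀ ℕ) : MvPowerSeries.coeff a (filterGerm P g).1 =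
      if P a then MvPowerSeries.coeff a g.1 else 0 := rfl

/-- The exponents are split into the box below `(N, M)`, those with first entry at least `N`, and
the rest; each partial series converges. -/
theorem exists_eq_polyGerm_add (g : HolGerm 2) (N M : ℕ) : ∃ p h₀ h₁,
    g = polyGerm 2 p + coord 0 ^ N * h₀ + coord 1 ^ M * h₁ := by
  classical
  let P : (Fin 2 →₀ ℕ) → Prop := fun m => m 0 < N ∧ m 1 < M
  let Q : (Fin 2 →₀ ℕ) → Prop := fun m => N ≤ m 0
  let R : (Fin 2 →₀ ℕ) → Prop := fun m => m 0 < N ∧ M ≤ m 1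
  obtain ⟨h₀, hh₀⟩ : coord 0 ^ N ∣ filterGerm Q g := coord_pow_dvd fun m hm => by
    rw [coeff_filterGerm, if_neg (by simpa [Q] using hm)]
  obtain ⟨h₁, hh₁⟩ : coord 1 ^ M ∣ filterGerm R g := coord_pow_dvd fun m hm => by
    rw [coeff_filterGerm, if_neg (by simp only [R]; omega)]
  let b : Fin 2 →₀ ℕ := Finsupp.equivFunOnFinite.symm ![N, M]
  have hb : ∀ m, P m → m ∈ Finset.Iic b := fun m hm => by
    rw [Finset.mem_Iic]
    intro i
    fin_cases i
    · exact hm.1.le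
    · exact hm.2.le
  let p : MvPolynomial (Fin 2) ℂ := ∑ m ∈ Finset.Iic b, MvPolynomial.monomial m
    (MvPowerSeries.coeff m (filterGerm P g).1)
  refine ⟨p, h₀, h₁, Subtype.ext ?_⟩
  rw [← hh₀, ← hh₁]
  ext m
  change _ = MvPowerSeries.coeff m ((polyGerm 2 p).1 + (filterGerm Q g).1 + (filterGerm R g).1)
  rw [map_add, map_add, coe_polyGerm, MvPolynomial.coeff_coe, coeff_filterGerm, coeff_filterGerm]
  simp only [p, MvPolynomial.coeff_sum, MvPolynomial.coeff_monomial, Finset.sum_ite_eq',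
    coeff_filterGerm]
  by_cases h0 : m 0 < N
  · by_cases h1 : m 1 < M
    · rw [if_pos (hb m ⟨h0, h1⟩), if_pos ⟨h0, h1⟩, if_neg (by simp only [Q]; omega),
        if_neg (by simp only [R]; omega), add_zero, add_zero]
    · rw [if_neg (c := P m) (by simp only [P]; omega), if_neg (c := Q m) (by simp only [Q]; omega),
        if_pos (c := R m) ⟨h0, by omega⟩]
      simp
  · rw [if_neg (c := P m) (by simp only [P]; omega), if_pos (c := Q m) (by simp only [Q]; omega),
      if_neg (c := R m) (by simp only [R]; omega)]
    simp

instance : IsDomain (HolGerm n) :=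
  have : IsDomain (MvPowerSeries (Fin n) ℂ) := NoZeroDivisors.to_isDomain _
  inferInstance

/-- Every monomial occurring in `p` is divisible by one of the two powers, so the germs `h₀`, `h₁`
need not be polynomials. -/
theorem mem_of_polyGerm_eq {J : Ideal (MvPolynomial (Fin 2) ℂ)} {N M : ℕ}
    (h0 : MvPolynomial.X 0 ^ N ∈ J) (h1 : MvPolynomial.X 1 ^ M ∈ J) {p : MvPolynomial (Fin 2) ℂ}
    {h₀ h₁ : HolGerm 2} (hp : polyGerm 2 p = coord 0 ^ N * h₀ + coord 1 ^ M * h₁) : p ∈ J := by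
  rw [p.as_sum]
  refine sum_mem fun m hm => ?_
  have hm' : N ≤ m 0 ∨ M ≤ m 1 := by
    by_contra! h
    rw [MvPolynomial.mem_support_iff, ← MvPolynomial.coeff_coe, ← coe_polyGerm, hp] at hm
    apply hm
    change MvPowerSeries.coeff m ((coord 0 ^ N * h₀).1 + (coord 1 ^ M * h₁).1) = 0
    rw [map_add, coeff_eq_zero_of_coord_pow_dvd (dvd_mul_right _ _) h.1,
      coeff_eq_zero_of_coord_pow_dvd (dvd_mul_right _ _) h.2, add_zero]
  have key : ∀ (i : Fin 2) (K : ℕ), K ≤ m i → MvPolynomial.X i ^ K ∈ J →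
      MvPolynomial.monomial m (MvPolynomial.coeff m p) ∈ J := by
    intro i K hK hJ
    have : m = (m - Finsupp.single i K) + Finsupp.single i K :=
      (tsub_add_cancel_of_le (by simpa using hK)).symm
    rw [this, ← mul_one (MvPolynomial.coeff _ p), ← MvPolynomial.monomial_mul,
      ← MvPolynomial.X_pow_eq_monomial]
    exact J.mul_mem_left _ hJ
  rcases hm' with h | h
  · exact key 0 N h h0
  · exact key 1 M h h1

variable {f : MvPolynomial (Fin 2) ℂ}

theorem mem_map_jacobianIdeal_iff {g : HolGerm 2} :
    g ∈ (jacobianIdeal f).map (polyGerm 2) ↔ ∃ a b,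
      a * polyGerm 2 (MvPolynomial.pderiv 0 f) + b * polyGerm 2 (MvPolynomial.pderiv 1 f) = g := by
  have : (polyGerm 2) '' Set.range (fun i => MvPolynomial.pderiv i f) =
      {polyGerm 2 (MvPolynomial.pderiv 0 f), polyGerm 2 (MvPolynomial.pderiv 1 f)} := by
    ext; simp [Fin.exists_fin_two, eq_comm]
  rw [jacobianIdeal, Ideal.map_span, this, Ideal.mem_span_pair]

theorem derivation_polyGerm_mem (θ : Derivation ℂ (HolGerm 2) (HolGerm 2)) :
    θ (polyGerm 2 f) ∈ (jacobianIdeal f).map (polyGerm 2) := by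
  rw [derivation_polyGerm, Fin.sum_univ_two]
  exact mem_map_jacobianIdeal_iff.mpr ⟨_, _, rfl⟩

theorem coord_pow_mem {J : Ideal (MvPolynomial (Fin 2) ℂ)} {N : ℕ} {i : Fin 2}
    (h : MvPolynomial.X i ^ N ∈ J) : coord i ^ N ∈ J.map (polyGerm 2) := by
  have := Ideal.mem_map_of_mem (polyGerm 2) h
  rwa [map_pow, polyGerm, MvPolynomial.aeval_X] at this

theorem exists_eq_polyGerm_add_mem {J : Ideal (MvPolynomial (Fin 2) ℂ)} {N M : ℕ}
    (h0 : MvPolynomial.X 0 ^ N ∈ J) (h1 : MvPolynomial.X 1 ^ M ∈ J) (g : HolGerm 2) :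
    ∃ p, g - polyGerm 2 p ∈ J.map (polyGerm 2) := by
  obtain ⟨p, a, b, h⟩ := exists_eq_polyGerm_add g N M
  refine ⟨p, ?_⟩
  have : g - polyGerm 2 p = coord 0 ^ N * a + coord 1 ^ M * b := by rw [h]; ring
  rw [this]
  exact add_mem (Ideal.mul_mem_right _ _ (coord_pow_mem h0))
    (Ideal.mul_mem_right _ _ (coord_pow_mem h1))

/-- Truncating the two germ coefficients to polynomials changes the combination only by multiples of
the powers of the coordinates, which already lie in the Jacobian ideal. -/
theorem mem_jacobianIdeal_of_polyGerm_mem {N M : ℕ}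
    (h0 : MvPolynomial.X 0 ^ N ∈ jacobianIdeal f) (h1 : MvPolynomial.X 1 ^ M ∈ jacobianIdeal f)
    {p : MvPolynomial (Fin 2) ℂ} (hp : polyGerm 2 p ∈ (jacobianIdeal f).map (polyGerm 2)) :
    p ∈ jacobianIdeal f := by
  obtain ⟨a, b, hab⟩ := mem_map_jacobianIdeal_iff.mp hp
  obtain ⟨a', a₀, a₁, ha⟩ := exists_eq_polyGerm_add a N M
  obtain ⟨b', b₀, b₁, hb⟩ := exists_eq_polyGerm_add b N M
  have : p - (a' * MvPolynomial.pderiv 0 f + b' * MvPolynomial.pderiv 1 f) ∈ jacobianIdeal f := by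
    refine mem_of_polyGerm_eq h0 h1 (h₀ := a₀ * polyGerm 2 (MvPolynomial.pderiv 0 f) +
      b₀ * polyGerm 2 (MvPolynomial.pderiv 1 f)) (h₁ := a₁ * polyGerm 2 (MvPolynomial.pderiv 0 f) +
      b₁ * polyGerm 2 (MvPolynomial.pderiv 1 f)) ?_
    rw [map_sub, ← hab, ha, hb]
    simp only [map_add, map_mul]
    ring
  exact (Submodule.sub_mem_iff_left _ (mem_jacobianIdeal_iff.mpr ⟨a', b', rfl⟩)).mp this

/-- Powers of the two coordinates form a regular sequence: the cofactors satisfy `y^M s = x^N t`,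
whence `x^N ∣ s`. -/
theorem dvd_of_dvd_coord_pow_mul {N M : ℕ} {a g : HolGerm 2} (h0 : g ∣ coord 0 ^ N * a)
    (h1 : g ∣ coord 1 ^ M * a) : g ∣ a := by
  obtain ⟨s, hs⟩ := h0
  obtain ⟨t, ht⟩ := h1
  have hX : ∀ (i : Fin 2) (K : ℕ), (coord i : HolGerm 2) ^ K ≠ 0 := fun i K => by
    refine pow_ne_zero _ fun h => ?_
    have h2 := congrArg (fun g : HolGerm 2 => MvPowerSeries.coeff (Finsupp.single i 1) g.1) h
    exact one_ne_zero ((MvPowerSeries.coeff_index_single_self_X i).symm.trans h2)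
  rcases eq_or_ne g 0 with rfl | hg
  · rw [zero_mul] at hs
    rw [(mul_eq_zero.mp hs).resolve_left (hX 0 N)]
  have h : coord 1 ^ M * s = coord 0 ^ N * t := by
    apply mul_left_cancel₀ hg
    linear_combination coord 0 ^ N * ht - coord 1 ^ M * hs
  obtain ⟨u, rfl⟩ : coord 0 ^ N ∣ s := by
    refine coord_pow_dvd fun m hm => ?_
    have h2 : MvPowerSeries.coeff (Finsupp.single 1 M + m) (coord 1 ^ M * s).1 = 0 := by
      rw [h]
      refine coeff_eq_zero_of_coord_pow_dvd (dvd_mul_right _ _) ?_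
      simpa using hm
    change MvPowerSeries.coeff _ (MvPowerSeries.X 1 ^ M * s.1) = 0 at h2
    rwa [MvPowerSeries.X_pow_eq, MvPowerSeries.coeff_add_monomial_mul, one_mul] at h2
  exact ⟨u, mul_left_cancel₀ (hX 0 N) (by rw [hs]; ring)⟩

/-- Exactness of the Koszul complex without unique factorization of germs: writing `x^N` and `y^M`
through the derivatives and using the syzygy, `∂f/∂y` divides both `x^N a` and `y^M a`, hence `a`;
similarly for `b`. -/
theorem dvd_of_syzygy {N M : ℕ}
    (h0 : MvPolynomial.X 0 ^ N ∈ jacobianIdeal f) (h1 : MvPolynomial.X 1 ^ M ∈ jacobianIdeal f)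
    {a b : HolGerm 2} (h : a * polyGerm 2 (MvPolynomial.pderiv 0 f) +
      b * polyGerm 2 (MvPolynomial.pderiv 1 f) = 0) :
    polyGerm 2 (MvPolynomial.pderiv 1 f) ∣ a ∧ polyGerm 2 (MvPolynomial.pderiv 0 f) ∣ b := by
  obtain ⟨u, v, huv⟩ := mem_map_jacobianIdeal_iff.mp (coord_pow_mem h0)
  obtain ⟨s, t, hst⟩ := mem_map_jacobianIdeal_iff.mp (coord_pow_mem h1)
  constructor
  · refine dvd_of_dvd_coord_pow_mul (N := N) (M := M) ⟨v * a - u * b, ?_⟩ ⟨t * a - s * b, ?_⟩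
    · linear_combination (-a) * huv + u * h
    · linear_combination (-a) * hst + s * h
  · refine dvd_of_dvd_coord_pow_mul (N := N) (M := M) ⟨u * b - v * a, ?_⟩ ⟨s * b - t * a, ?_⟩
    · linear_combination (-b) * huv + v * h
    · linear_combination (-b) * hst + t * h

end Germs

/-! ### Admissible directions and the Euler field -/

section TangentSpace

open MvPolynomial

/-- The ideal of `𝒪` generated by the partial derivatives of `f`. -/
def jacobianGerm (f : MvPolynomial (Fin 2) ℂ) : Ideal (HolGerm 2) :=
  (jacobianIdeal f).map (polyGerm 2)

/-- The `g ∈ 𝒪` such that every logarithmic vector field of `f` lifts to `f + ε g`. -/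
def admissibleGerms (f : MvPolynomial (Fin 2) ℂ) : Submodule ℂ (HolGerm 2) where
  carrier := {g | ∀ (θ : Derivation ℂ (HolGerm 2) (HolGerm 2)) (α : HolGerm 2),
    θ (polyGerm 2 f) = α * polyGerm 2 f → θ g - α * g ∈ jacobianGerm f}
  zero_mem' θ α _ := by simp
  add_mem' {g h} hg hh θ α hθ := by
    have := add_mem (hg θ α hθ) (hh θ α hθ)
    rwa [show θ g - α * g + (θ h - α * h) = θ (g + h) - α * (g + h) by rw [map_add]; ring] at this
  smul_mem' c g hg θ α hθ := by
    have := Submodule.smul_of_tower_mem (jacobianGerm f) c (hg θ α hθ)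
    rwa [smul_sub, ← mul_smul_comm, ← θ.map_smul] at this

instance (f : MvPolynomial (Fin 2) ℂ) : AddCommGroup (admissibleGerms f) :=
  Submodule.addCommGroup _

/-- The admissible first order directions modulo the trivial ones. -/
abbrev AdmissibleTangent (f : MvPolynomial (Fin 2) ℂ) : Type :=
  admissibleGerms f ⧸ ((jacobianGerm f).restrictScalars ℂ).submoduleOf (admissibleGerms f)

variable {w : Fin 2 → ℕ} {k : ℕ} {f : MvPolynomial (Fin 2) ℂ}

/-- The Euler vector field of the weights `w`. -/
def eulerGerm (w : Fin 2 → ℕ) : Derivation ℂ (HolGerm 2) (HolGerm 2) :=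
  ∑ i, ((w i : HolGerm 2) * coord i) • pderivGerm i

theorem eulerGerm_polyGerm (p : MvPolynomial (Fin 2) ℂ) :
    eulerGerm w (polyGerm 2 p) = polyGerm 2 (∑ i, w i • (X i * pderiv i p)) := by
  classical
  have h : ∀ j, eulerGerm w (coord j) = (w j : HolGerm 2) * coord j := fun j => by
    simp only [eulerGerm, Fin.sum_univ_two, Derivation.coe_add, Pi.add_apply, Derivation.coe_smul,
      Pi.smul_apply, pderivGerm_coord, smul_eq_mul]
    fin_cases j <;> simp
  have hX : ∀ j, polyGerm 2 (X j) = coord j := fun j => by simp [polyGerm]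
  rw [derivation_polyGerm, map_sum]
  exact Finset.sum_congr rfl fun i _ => by rw [h, map_nsmul, map_mul, hX, nsmul_eq_mul, mul_assoc]

theorem eulerGerm_polyGerm_of_isWeightedHomogeneous (hf : f.IsWeightedHomogeneous w k) :
    eulerGerm w (polyGerm 2 f) = (k : HolGerm 2) * polyGerm 2 f := by
  rw [eulerGerm_polyGerm, hf.sum_weight_X_mul_pderiv, map_nsmul, nsmul_eq_mul]

theorem weightedHomogeneousComponent_euler (p : MvPolynomial (Fin 2) ℂ) (m : ℕ) :
    weightedHomogeneousComponent w m (∑ i, w i • (X i * pderiv i p)) =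
      m • weightedHomogeneousComponent w m p := by
  induction p using MvPolynomial.induction_on' with
  | monomial s c =>
    have h := isWeightedHomogeneous_monomial w s c rfl
    rw [h.sum_weight_X_mul_pderiv, map_nsmul]
    rcases eq_or_ne m (Finsupp.weight w s) with rfl | hm
    · rfl
    · rw [h.weightedHomogeneousComponent_ne m hm, nsmul_zero, nsmul_zero]
  | add p q hp hq =>
    simp only [map_add, mul_add, smul_add, Finset.sum_add_distrib] at hp hq ⊢
    rw [hp, hq]

theorem mem_of_forall_weightedHomogeneousComponent_mem {σ : Type*} {w : σ → ℕ}
    {J : Ideal (MvPolynomial σ ℂ)} {p : MvPolynomial σ ℂ}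
    (h : ∀ m, weightedHomogeneousComponent w m p ∈ J) : p ∈ J := by
  rw [← finsum_weightedHomogeneousComponent w p]
  exact finsum_induction (· ∈ J) J.zero_mem (fun _ _ => J.add_mem) h

theorem isUnit_natCast_germ (hk : k ≠ 0) : IsUnit (k : HolGerm 2) := by
  rw [← map_natCast (algebraMap ℂ (HolGerm 2))]
  exact (isUnit_iff_ne_zero.mpr (Nat.cast_ne_zero.mpr hk)).map _

theorem polyGerm_mem_jacobianGerm (hf : f.IsWeightedHomogeneous w k) (hk : k ≠ 0) :
    polyGerm 2 f ∈ jacobianGerm f := by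
  have h := derivation_polyGerm_mem (f := f) (eulerGerm w)
  rw [eulerGerm_polyGerm_of_isWeightedHomogeneous hf] at h
  exact (Ideal.unit_mul_mem_iff_mem _ (isUnit_natCast_germ hk)).mp h

variable {N M : ℕ}

/-- The Euler field treats `p` as it treats `f`, so any logarithmic field can be corrected by it to
one that kills `f`. -/
theorem polyGerm_mem_admissibleGerms (hf : f.IsWeightedHomogeneous w k) (hk : k ≠ 0)
    (h0 : X 0 ^ N ∈ jacobianIdeal f) (h1 : X 1 ^ M ∈ jacobianIdeal f)
    {p : MvPolynomial (Fin 2) ℂ} (hp : p.IsWeightedHomogeneous w k) :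
    polyGerm 2 p ∈ admissibleGerms f := by
  intro θ α hθ
  -- This field annihilates `f`; its two coefficients form a syzygy of the derivatives.
  let η := (k : HolGerm 2) • θ - α • eulerGerm w
  have hη : ∀ g, η g = k * θ g - α * eulerGerm w g := fun g => rfl
  have h2 : η (polyGerm 2 f) = 0 := by
    rw [hη, hθ, eulerGerm_polyGerm_of_isWeightedHomogeneous hf]
    ring
  rw [derivation_polyGerm, Fin.sum_univ_two] at h2
  obtain ⟨ha, hb⟩ := dvd_of_syzygy h0 h1 h2
  have hmem : ∀ i, polyGerm 2 (pderiv i f) ∈ jacobianGerm f := fun i =>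
    Ideal.mem_map_of_mem _ (Ideal.subset_span ⟨i, rfl⟩)
  have h3 : η (polyGerm 2 p) ∈ jacobianGerm f := by
    rw [derivation_polyGerm, Fin.sum_univ_two]
    exact add_mem (Ideal.mul_mem_right _ _ (Ideal.mem_of_dvd _ ha (hmem 1)))
      (Ideal.mul_mem_right _ _ (Ideal.mem_of_dvd _ hb (hmem 0)))
  rw [hη, eulerGerm_polyGerm_of_isWeightedHomogeneous hp] at h3
  rw [← Ideal.unit_mul_mem_iff_mem _ (isUnit_natCast_germ hk)]
  convert h3 using 1
  ring

theorem eulerGerm_mem_jacobianGerm (hf : f.IsWeightedHomogeneous w k) {g : HolGerm 2}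
    (hg : g ∈ jacobianGerm f) : eulerGerm w g ∈ jacobianGerm f := by
  have key : ∀ i a, eulerGerm w (a * polyGerm 2 (pderiv i f)) ∈ jacobianGerm f := by
    intro i a
    have hmem : polyGerm 2 (pderiv i f) ∈ jacobianGerm f :=
      Ideal.mem_map_of_mem _ (Ideal.subset_span ⟨i, rfl⟩)
    obtain ⟨e, he⟩ := exists_isWeightedHomogeneous_pderiv hf i
    rw [Derivation.leibniz, eulerGerm_polyGerm_of_isWeightedHomogeneous he, smul_eq_mul,
      smul_eq_mul]
    exact add_mem (Ideal.mul_mem_left _ _ (Ideal.mul_mem_left _ _ hmem))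
      (Ideal.mul_mem_right _ _ hmem)
  obtain ⟨a, b, rfl⟩ := mem_map_jacobianIdeal_iff.mp hg
  rw [map_add]
  exact add_mem (key 0 a) (key 1 b)

/-- Admissibility for the Euler field makes the weight `m` component, times `m - k`, an element of
the Jacobian ideal; for `m ≠ k` the scalar is invertible. -/
theorem exists_sub_polyGerm_mem (hf : f.IsWeightedHomogeneous w k)
    (h0 : X 0 ^ N ∈ jacobianIdeal f) (h1 : X 1 ^ M ∈ jacobianIdeal f)
    {g : HolGerm 2} (hg : g ∈ admissibleGerms f) :
    ∃ p, p.IsWeightedHomogeneous w k ∧ g - polyGerm 2 p ∈ jacobianGerm f := by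
  obtain ⟨p, hp⟩ := exists_eq_polyGerm_add_mem h0 h1 g
  change _ ∈ jacobianGerm f at hp
  refine ⟨weightedHomogeneousComponent w k p, weightedHomogeneousComponent_isWeightedHomogeneous
    _ _, ?_⟩
  have h2 := hg _ _ (eulerGerm_polyGerm_of_isWeightedHomogeneous hf)
  have h3 : polyGerm 2 (∑ i, w i • (X i * pderiv i p) - k • p) ∈ jacobianGerm f := by
    rw [map_sub, ← eulerGerm_polyGerm, map_nsmul, nsmul_eq_mul]
    have h4 := sub_mem h2 (sub_mem (eulerGerm_mem_jacobianGerm hf hp)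
      (Ideal.mul_mem_left _ (k : HolGerm 2) hp))
    rw [map_sub] at h4
    convert h4 using 1
    ring
  have h5 := mem_jacobianIdeal_of_polyGerm_mem h0 h1 h3
  have h6 : p - weightedHomogeneousComponent w k p ∈ jacobianIdeal f := by
    refine mem_of_forall_weightedHomogeneousComponent_mem (w := w) fun m => ?_
    rcases eq_or_ne m k with rfl | hm
    · rw [map_sub, (weightedHomogeneousComponent_isWeightedHomogeneous
        m p).weightedHomogeneousComponent_same, sub_self]
      exact zero_mem _
    · rw [map_sub, (weightedHomogeneousComponent_isWeightedHomogeneous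
        k p).weightedHomogeneousComponent_ne m hm, sub_zero]
      have h7 := isHomogeneous_jacobianIdeal hf h5 m
      rw [map_sub, weightedHomogeneousComponent_euler, map_nsmul, nsmul_eq_mul, nsmul_eq_mul,
        ← sub_mul, ← map_natCast C, ← map_natCast C, ← C_sub] at h7
      refine (Ideal.unit_mul_mem_iff_mem _ ?_).mp h7
      exact (isUnit_iff_ne_zero.mpr (sub_ne_zero.mpr (Nat.cast_injective.ne hm))).map C
  have h8 := add_mem hp (Ideal.mem_map_of_mem (polyGerm 2) h6)
  rw [map_sub] at h8
  convert h8 using 1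
  ring

theorem nonempty_admissibleTangent_equiv (hf : f.IsWeightedHomogeneous w k) (hk : k ≠ 0)
    (h0 : X 0 ^ N ∈ jacobianIdeal f) (h1 : X 1 ^ M ∈ jacobianIdeal f) :
    Nonempty (AdmissibleTangent f ≃ₗ[ℂ] JacobianQuotient w k f) := by
  let ψ : weightedHomogeneousSubmodule ℂ w k →ₗ[ℂ] AdmissibleTangent f :=
    (Submodule.mkQ _).comp (LinearMap.codRestrict (admissibleGerms f)
      ((polyGerm 2).toLinearMap.comp (Submodule.subtype _))
      fun p => polyGerm_mem_admissibleGerms hf hk h0 h1 p.2)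
  have hsurj : Function.Surjective ψ := by
    intro z
    obtain ⟨g, rfl⟩ := Submodule.mkQ_surjective _ z
    obtain ⟨p, hp, hgp⟩ := exists_sub_polyGerm_mem hf h0 h1 g.2
    refine ⟨⟨p, hp⟩, ?_⟩
    refine ((Submodule.Quotient.eq _).mpr ?_).symm
    exact hgp
  have hker : LinearMap.ker ψ = ((jacobianIdeal f).restrictScalars ℂ).submoduleOf
      (weightedHomogeneousSubmodule ℂ w k) := by
    ext p
    rw [LinearMap.mem_ker]
    refine (Submodule.Quotient.mk_eq_zero _).trans ?_
    change polyGerm 2 p.1 ∈ jacobianGerm f ↔ p.1 ∈ jacobianIdeal f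
    exact ⟨mem_jacobianIdeal_of_polyGerm_mem h0 h1, Ideal.mem_map_of_mem _⟩
  exact ⟨((Submodule.quotEquivOfEq _ _ hker.symm).trans
    (ψ.quotKerEquivOfSurjective hsurj)).symm⟩

end TangentSpace

/-! ### Flat ideals over a base with square-zero maximal ideal -/

section FirstOrder

variable {n : ℕ} {A : Type} [CommRing A] [Algebra ℂ A]

theorem restrictFun_smul (π : A →ₐ[ℂ] ℂ) (a : A) (z : A ⊗[ℂ] HolGerm n) :
    restrictFun n π (a • z) = π a • restrictFun n π z := by
  induction z using TensorProduct.induction_on with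
  | zero => simp
  | add z w hz hw => simp only [smul_add, map_add, hz, hw]
  | tmul a' x => simp [TensorProduct.smul_tmul', restrictFun_tmul, mul_smul]

variable {ι : Type} [Fintype ι] [DecidableEq ι]

/-- A basis of the maximal ideal of a local `ℂ`-algebra with residue map `π`, whose maximal ideal
has square zero. -/
structure FirstOrderBasis (π : A →ₐ[ℂ] ℂ) (ι : Type) [Fintype ι] [DecidableEq ι] where
  /-- the basis vectors -/
  gen : ι → A
  /-- the coordinates -/
  coeff : ι → A →ₗ[ℂ] ℂ
  map_gen : ∀ i, π (gen i) = 0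
  gen_mul_gen : ∀ i j, gen i * gen j = 0
  coeff_gen : ∀ i j, coeff i (gen j) = if i = j then 1 else 0
  eq_sum : ∀ a, a = algebraMap ℂ A (π a) + ∑ i, coeff i a • gen i

namespace FirstOrderBasis

variable {π : A →ₐ[ℂ] ℂ} (b : FirstOrderBasis π ι)

theorem coeff_sum_smul_gen (c : ι → ℂ) (i : ι) : b.coeff i (∑ j, c j • b.gen j) = c i := by
  simp [b.coeff_gen]

theorem coeff_one (i : ι) : b.coeff i 1 = 0 := by
  have h := b.eq_sum 1
  rw [map_one, map_one, left_eq_add] at h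
  rw [← b.coeff_sum_smul_gen (fun j => b.coeff j 1) i, h, map_zero]

theorem coeff_algebraMap (c : ℂ) (i : ι) : b.coeff i (algebraMap ℂ A c) = 0 := by
  rw [Algebra.algebraMap_eq_smul_one, map_smul, b.coeff_one, smul_zero]

theorem sum_smul_gen_mul (c d : ι → ℂ) : (∑ i, c i • b.gen i) * ∑ i, d i • b.gen i = 0 := by
  simp [Finset.sum_mul_sum, b.gen_mul_gen]

theorem coeff_mul (a a' : A) (i : ι) :
    b.coeff i (a * a') = π a * b.coeff i a' + π a' * b.coeff i a := by
  have h : a * a' = algebraMap ℂ A (π a * π a') +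
      ∑ j, (π a * b.coeff j a' + π a' * b.coeff j a) • b.gen j := by
    have h1 := b.sum_smul_gen_mul (fun j => b.coeff j a) fun j => b.coeff j a'
    conv_lhs => rw [b.eq_sum a, b.eq_sum a']
    rw [add_mul, mul_add, mul_add, h1, ← map_mul]
    simp only [add_smul, mul_smul, Finset.sum_add_distrib, ← Finset.smul_sum]
    rw [Algebra.smul_def (π a), Algebra.smul_def (π a')]
    ring
  rw [h, map_add, b.coeff_algebraMap, zero_add, b.coeff_sum_smul_gen]

theorem mul_gen (a : A) (i : ι) : a * b.gen i = π a • b.gen i := by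
  conv_lhs => rw [b.eq_sum a]
  rw [add_mul, Finset.sum_mul, Finset.sum_eq_zero, add_zero, Algebra.smul_def]
  intro j _
  rw [smul_mul_assoc, b.gen_mul_gen, smul_zero]

theorem exists_eq_tmul_add {W : Type} [AddCommGroup W] [Module ℂ W] (z : A ⊗[ℂ] W) :
    ∃ (x : W) (y : ι → W), z = 1 ⊗ₜ x + ∑ i, b.gen i ⊗ₜ y i := by
  induction z using TensorProduct.induction_on with
  | zero => exact ⟨0, 0, by simp⟩
  | tmul a x =>
    refine ⟨π a • x, fun i => b.coeff i a • x, ?_⟩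
    conv_lhs => rw [b.eq_sum a]
    simp only [TensorProduct.add_tmul, TensorProduct.sum_tmul, TensorProduct.tmul_smul,
      TensorProduct.smul_tmul', Algebra.algebraMap_eq_smul_one]
  | add z z' hz hz' =>
    obtain ⟨x, y, rfl⟩ := hz
    obtain ⟨x', y', rfl⟩ := hz'
    refine ⟨x + x', y + y', ?_⟩
    simp only [TensorProduct.tmul_add, Pi.add_apply, Finset.sum_add_distrib]
    abel

/-- The coefficient of `gen i` of a function on `ℂⁿ × S`. -/
def germCoeff (i : ι) : A ⊗[ℂ] HolGerm n →ₗ[ℂ] HolGerm n :=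
  (TensorProduct.lid ℂ (HolGerm n)).toLinearMap ∘ₗ LinearMap.rTensor (HolGerm n) (b.coeff i)

theorem germCoeff_tmul (i : ι) (a : A) (h : HolGerm n) :
    b.germCoeff i (a ⊗ₜ h) = b.coeff i a • h := by
  simp [germCoeff]

/-- The function `h + ∑ gᵢ εᵢ` on `ℂⁿ × S`. -/
def germMk (h : HolGerm n) (g : ι → HolGerm n) : A ⊗[ℂ] HolGerm n :=
  1 ⊗ₜ h + ∑ i, b.gen i ⊗ₜ g i

theorem restrictFun_germMk (h : HolGerm n) (g : ι → HolGerm n) :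
    restrictFun n π (b.germMk h g) = h := by
  simp [germMk, restrictFun_tmul, b.map_gen]

theorem germCoeff_germMk (h : HolGerm n) (g : ι → HolGerm n) (i : ι) :
    b.germCoeff i (b.germMk h g) = g i := by
  simp [germMk, germCoeff_tmul, b.coeff_one, b.coeff_gen]

theorem germMk_eq (z : A ⊗[ℂ] HolGerm n) :
    b.germMk (restrictFun n π z) (fun i => b.germCoeff i z) = z := by
  obtain ⟨x, y, hz⟩ := b.exists_eq_tmul_add z
  change z = b.germMk x y at hz
  rw [hz, restrictFun_germMk]
  congr 1
  funext i
  rw [germCoeff_germMk]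

theorem germ_ext {z z' : A ⊗[ℂ] HolGerm n} (h : restrictFun n π z = restrictFun n π z')
    (h' : ∀ i, b.germCoeff i z = b.germCoeff i z') : z = z' := by
  rw [← b.germMk_eq z, ← b.germMk_eq z', h]
  congr 1
  exact funext h'

theorem germCoeff_mul (z z' : A ⊗[ℂ] HolGerm n) (i : ι) : b.germCoeff i (z * z') =
    restrictFun n π z * b.germCoeff i z' + restrictFun n π z' * b.germCoeff i z := by
  induction z using TensorProduct.induction_on with
  | zero => simp
  | add z w hz hw =>
    rw [add_mul, map_add, hz, hw, map_add, map_add]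
    ring
  | tmul a x =>
    induction z' using TensorProduct.induction_on with
    | zero => simp
    | add z w hz hw =>
      rw [mul_add, map_add, hz, hw, map_add, map_add]
      ring
    | tmul a' x' =>
      rw [Algebra.TensorProduct.tmul_mul_tmul]
      simp only [germCoeff_tmul, restrictFun_tmul, b.coeff_mul, add_smul, smul_mul_smul_comm]
      rw [mul_comm x' x]

theorem germMk_mul (h h' : HolGerm n) (g g' : ι → HolGerm n) :
    b.germMk h g * b.germMk h' g' = b.germMk (h * h') (fun i => h * g' i + h' * g i) := by
  refine b.germ_ext ?_ fun i => ?_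
  · simp [restrictFun_germMk]
  · simp [restrictFun_germMk, germCoeff_germMk, germCoeff_mul]

theorem germMk_add (h h' : HolGerm n) (g g' : ι → HolGerm n) :
    b.germMk h g + b.germMk h' g' = b.germMk (h + h') (fun i => g i + g' i) := by
  refine b.germ_ext ?_ fun i => ?_
  · simp [restrictFun_germMk]
  · simp [germCoeff_germMk]

theorem germCoeff_gen_smul (i j : ι) (z : A ⊗[ℂ] HolGerm n) :
    b.germCoeff i (b.gen j • z) = if i = j then restrictFun n π z else 0 := by
  induction z using TensorProduct.induction_on with
  | zero => simp
  | add z w hz hw =>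
    simp only [smul_add, map_add, hz, hw]
    split_ifs <;> simp
  | tmul a' x =>
    rw [TensorProduct.smul_tmul', germCoeff_tmul, smul_eq_mul, coeff_mul, b.map_gen,
      b.coeff_gen, restrictFun_tmul]
    split_ifs <;> simp

theorem mem_span_germMk_iff {f : HolGerm n} {g : ι → HolGerm n} {z : A ⊗[ℂ] HolGerm n} :
    z ∈ Ideal.span {b.germMk f g} ↔ ∃ (u : HolGerm n) (v : ι → HolGerm n),
      restrictFun n π z = u * f ∧ ∀ i, b.germCoeff i z = u * g i + v i * f := by
  rw [Ideal.mem_span_singleton']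
  constructor
  · rintro ⟨c, rfl⟩
    refine ⟨restrictFun n π c, fun i => b.germCoeff i c, ?_, fun i => ?_⟩
    · rw [map_mul, restrictFun_germMk]
    · rw [germCoeff_mul, restrictFun_germMk, germCoeff_germMk, mul_comm f]
  · rintro ⟨u, v, h, h'⟩
    refine ⟨b.germMk u v, b.germ_ext ?_ fun i => ?_⟩
    · rw [map_mul, restrictFun_germMk, restrictFun_germMk, h]
    · rw [germCoeff_mul, restrictFun_germMk, restrictFun_germMk, germCoeff_germMk,
        germCoeff_germMk, h', mul_comm f]

theorem restrictFun_surjective (b : FirstOrderBasis π ι) : Function.Surjective (restrictFun n π) := fun h =>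
  ⟨b.germMk h 0, b.restrictFun_germMk h 0⟩

theorem map_span_germMk (f : HolGerm n) (g : ι → HolGerm n) :
    (Ideal.span {b.germMk f g}).map (restrictFun n π) = Ideal.span {f} := by
  rw [Ideal.map_span, Set.image_singleton, restrictFun_germMk]

/-- A linear section of `q` gives an `A`-linear map from the free module `A ⊗ W` to the quotient. It
is bijective by comparing coefficients; injectivity uses that `f` is a nonzerodivisor. -/
theorem flat_quotient_span_germMk_of_surjective {W : Type} [AddCommGroup W] [Module ℂ W]
    {f : HolGerm n} (hf : f ≠ 0) (g : ι → HolGerm n) (q : HolGerm n →ₗ[ℂ] W)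
    (hqs : Function.Surjective q) (hq : ∀ x, q x = 0 ↔ ∃ u, x = u * f) :
    Module.Flat A ((A ⊗[ℂ] HolGerm n) ⧸ Ideal.span {b.germMk f g}) := by
  obtain ⟨s, hs⟩ := q.exists_rightInverse_of_surjective (LinearMap.range_eq_top.mpr hqs)
  have hs' : ∀ x, q (s x) = x := fun x => LinearMap.congr_fun hs x
  let Ψ : A ⊗[ℂ] W →ₗ[A] (A ⊗[ℂ] HolGerm n) ⧸ Ideal.span {b.germMk f g} :=
    (Ideal.Quotient.mkₐ A _).toLinearMap ∘ₗ LinearMap.baseChange A s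
  have hΨ : ∀ (x : W) (y : ι → W), Ψ (1 ⊗ₜ x + ∑ i, b.gen i ⊗ₜ y i) =
      Ideal.Quotient.mk _ (b.germMk (s x) fun i => s (y i)) := fun x y => by
    change Ideal.Quotient.mk _ (LinearMap.baseChange A s _) = _
    congr 1
    rw [germMk, map_add, map_sum]
    simp only [LinearMap.baseChange_tmul]
  have hinj : Function.Injective Ψ := by
    rw [injective_iff_map_eq_zero]
    intro z hz
    obtain ⟨x, y, rfl⟩ := b.exists_eq_tmul_add z
    rw [hΨ, Ideal.Quotient.eq_zero_iff_mem, mem_span_germMk_iff] at hz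
    obtain ⟨u, v, hu, hv⟩ := hz
    rw [restrictFun_germMk] at hu
    have hx : x = 0 := by rw [← hs' x, hq]; exact ⟨u, hu⟩
    rw [hx, map_zero] at hu
    have hu0 : u = 0 := (mul_eq_zero.mp hu.symm).resolve_right hf
    have hy : ∀ i, y i = 0 := fun i => by
      have := hv i
      rw [germCoeff_germMk, hu0, zero_mul, zero_add] at this
      rw [← hs' (y i), hq]
      exact ⟨_, this⟩
    simp [hx, hy]
  have hsurj : Function.Surjective Ψ := by
    intro z
    obtain ⟨z, rfl⟩ := Ideal.Quotient.mk_surjective z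
    obtain ⟨u, hu⟩ := (hq (restrictFun n π z - s (q (restrictFun n π z)))).mp
      (by rw [map_sub, hs', sub_self])
    let y : ι → HolGerm n := fun i => b.germCoeff i z - u * g i
    have hy : ∀ i, ∃ v, y i - s (q (y i)) = v * f := fun i =>
      (hq _).mp (by rw [map_sub, hs', sub_self])
    choose v hv using hy
    refine ⟨1 ⊗ₜ q (restrictFun n π z) + ∑ i, b.gen i ⊗ₜ q (y i), ?_⟩
    rw [hΨ, eq_comm, Ideal.Quotient.eq, mem_span_germMk_iff]
    refine ⟨u, v, ?_, fun i => ?_⟩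
    · rw [map_sub, restrictFun_germMk, hu]
    · rw [map_sub, germCoeff_germMk, ← hv]
      simp only [y]
      ring
  exact Module.Flat.of_linearEquiv (LinearEquiv.ofBijective Ψ ⟨hinj, hsurj⟩).symm

theorem flat_quotient_span_germMk {f : HolGerm n} (hf : f ≠ 0) (g : ι → HolGerm n) :
    Module.Flat A ((A ⊗[ℂ] HolGerm n) ⧸ Ideal.span {b.germMk f g}) := by
  refine b.flat_quotient_span_germMk_of_surjective hf g
    (Ideal.Quotient.mkₐ ℂ (Ideal.span {f})).toLinearMap Ideal.Quotient.mk_surjective fun x => ?_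
  refine Ideal.Quotient.eq_zero_iff_mem.trans ?_
  rw [Ideal.mem_span_singleton']
  simp only [eq_comm]

/-- Any lift `F` of `f` in `I` generates: modulo a multiple of `F` an element of `I` is `∑ εᵢ hᵢ`,
and flatness forces each `hᵢ` into `(f)`, so that `εᵢ hᵢ` is a multiple of `εᵢ F`. -/
theorem exists_eq_span_germMk {f : HolGerm n} {I : Ideal (A ⊗[ℂ] HolGerm n)}
    (hflat : Module.Flat A ((A ⊗[ℂ] HolGerm n) ⧸ I))
    (hI : I.map (restrictFun n π) = Ideal.span {f}) : ∃ g, I = Ideal.span {b.germMk f g} := by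
  have hres : ∀ z ∈ I, ∃ u, restrictFun n π z = u * f := fun z hz => by
    have := Ideal.mem_map_of_mem (restrictFun n π) hz
    rw [hI, Ideal.mem_span_singleton'] at this
    obtain ⟨u, hu⟩ := this
    exact ⟨u, hu.symm⟩
  obtain ⟨F, hF, hFf⟩ := (Ideal.mem_map_iff_of_surjective (restrictFun n π)
    b.restrictFun_surjective).mp (hI ▸ Ideal.mem_span_singleton_self f)
  refine ⟨fun i => b.germCoeff i F, ?_⟩
  have hFmk : b.germMk f (fun i => b.germCoeff i F) = F := by rw [← hFf, b.germMk_eq]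
  rw [hFmk]
  refine le_antisymm (fun z hz => ?_) (by rwa [Ideal.span_le, Set.singleton_subset_iff])
  obtain ⟨u, hu⟩ := hres z hz
  have hz' : z - b.germMk u 0 * F ∈ I := I.sub_mem hz (I.mul_mem_left _ hF)
  set z' := z - b.germMk u 0 * F with hz'_def
  have hz'0 : restrictFun n π z' = 0 := by
    rw [hz'_def, map_sub, map_mul, restrictFun_germMk, hFf, hu, sub_self]
  clear_value z'
  have hrel : ∑ i, b.gen i • Ideal.Quotient.mk I (1 ⊗ₜ[ℂ] b.germCoeff i z') = 0 := by
    have h1 : ∀ i, b.gen i • Ideal.Quotient.mk I (1 ⊗ₜ[ℂ] b.germCoeff i z') =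
        Ideal.Quotient.mk I (b.gen i ⊗ₜ b.germCoeff i z') := fun i => by
      rw [← Ideal.Quotient.mkₐ_eq_mk A, ← map_smul, TensorProduct.smul_tmul', smul_eq_mul, mul_one]
    rw [Finset.sum_congr rfl fun i _ => h1 i, ← map_sum, Ideal.Quotient.eq_zero_iff_mem]
    convert hz'
    conv_rhs => rw [← b.germMk_eq z', hz'0, germMk, TensorProduct.tmul_zero, zero_add]
  -- Equational criterion of flatness. The coefficients `a i j` satisfy `∑ εᵢ a i j = 0`, so they
  -- lie in the maximal ideal and vanish on the central fibre.
  obtain ⟨m, a, y, hy, ha⟩ := Module.Flat.isTrivialRelation_of_sum_smul_eq_zero hrel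
  have hπ : ∀ i j, π (a i j) = 0 := fun i j => by
    have := congrArg (b.coeff i) (ha j)
    simp only [mul_comm (b.gen _), b.mul_gen] at this
    rwa [b.coeff_sum_smul_gen (fun i => π (a i j)), map_zero] at this
  choose Y hY using fun j => Ideal.Quotient.mk_surjective (y j)
  have hv : ∀ i, ∃ v, b.germCoeff i z' = v * f := fun i => by
    have h1 : (1 : A) ⊗ₜ[ℂ] b.germCoeff i z' - ∑ j, a i j • Y j ∈ I := by
      rw [← Ideal.Quotient.eq]
      refine (hy i).trans ?_
      refine ((map_sum (Ideal.Quotient.mkₐ A I) _ _).trans (Finset.sum_congr rfl fun j _ => ?_)).symm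
      rw [map_smul, Ideal.Quotient.mkₐ_eq_mk, hY]
    obtain ⟨v, hv⟩ := hres _ h1
    refine ⟨v, ?_⟩
    have h2 : restrictFun n π (∑ j, a i j • Y j) = 0 := by
      rw [map_sum]
      exact Finset.sum_eq_zero fun j _ => by rw [restrictFun_smul, hπ, zero_smul]
    rw [← hv, map_sub, h2, restrictFun_tmul, map_one, one_smul, sub_zero]
  choose v hv using hv
  rw [← hFmk, mem_span_germMk_iff]
  refine ⟨u, v, hu, fun i => ?_⟩
  rw [← hv, hz'_def, map_sub, germCoeff_mul, restrictFun_germMk, germCoeff_germMk]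
  simp

end FirstOrderBasis

end FirstOrder

/-! ### Relative vector fields and their coefficients -/

section Lifting

variable {n : ℕ} {A : Type} [CommRing A] [Algebra ℂ A]

/-- The extension of a vector field on `ℂⁿ` to `ℂⁿ × S`, constant along `S`. -/
def baseChangeDer (A : Type) [CommRing A] [Algebra ℂ A]
    (θ : Derivation ℂ (HolGerm n) (HolGerm n)) :
    Derivation A (A ⊗[ℂ] HolGerm n) (A ⊗[ℂ] HolGerm n) :=
  Derivation.mk' (LinearMap.baseChange A θ.toLinearMap) fun x y => by
    induction x using TensorProduct.induction_on with
    | zero => simp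
    | add x x' hx hx' => simp only [add_mul, map_add, hx, hx', smul_eq_mul]; ring
    | tmul a g =>
      induction y using TensorProduct.induction_on with
      | zero => simp
      | add y y' hy hy' => simp only [mul_add, map_add, hy, hy', smul_eq_mul]; ring
      | tmul a' h =>
        rw [Algebra.TensorProduct.tmul_mul_tmul]
        simp only [LinearMap.baseChange_tmul, Derivation.coeFn_coe,
          Derivation.leibniz, TensorProduct.tmul_add, smul_eq_mul,
          Algebra.TensorProduct.tmul_mul_tmul]
        rw [mul_comm a' a]

theorem baseChangeDer_tmul (θ : Derivation ℂ (HolGerm n) (HolGerm n)) (a : A) (g : HolGerm n) :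
    baseChangeDer A θ (a ⊗ₜ g) = a ⊗ₜ θ g := rfl

theorem derivation_tmul (Θ : Derivation A (A ⊗[ℂ] HolGerm n) (A ⊗[ℂ] HolGerm n)) (a : A)
    (g : HolGerm n) : Θ (a ⊗ₜ g) = a • Θ (1 ⊗ₜ g) := by
  rw [← Θ.map_smul, TensorProduct.smul_tmul', smul_eq_mul, mul_one]

theorem restrictDer_apply (π : A →ₐ[ℂ] ℂ)
    (Θ : Derivation A (A ⊗[ℂ] HolGerm n) (A ⊗[ℂ] HolGerm n)) (g : HolGerm n) :
    restrictDer π Θ g = restrictFun n π (Θ (1 ⊗ₜ g)) := rfl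

theorem restrictFun_derivation (π : A →ₐ[ℂ] ℂ)
    (Θ : Derivation A (A ⊗[ℂ] HolGerm n) (A ⊗[ℂ] HolGerm n)) (z : A ⊗[ℂ] HolGerm n) :
    restrictFun n π (Θ z) = restrictDer π Θ (restrictFun n π z) := by
  induction z using TensorProduct.induction_on with
  | zero => simp
  | add z z' hz hz' => simp only [map_add, hz, hz']
  | tmul a g =>
    rw [derivation_tmul, restrictFun_smul, restrictFun_tmul, Derivation.map_smul,
      restrictDer_apply]

variable {ι : Type} [Fintype ι] [DecidableEq ι]

namespace FirstOrderBasis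

variable {π : A →ₐ[ℂ] ℂ} (b : FirstOrderBasis π ι)

/-- The coefficient of `gen i` of a relative vector field. -/
def derCoeff (i : ι) (Θ : Derivation A (A ⊗[ℂ] HolGerm n) (A ⊗[ℂ] HolGerm n)) :
    Derivation ℂ (HolGerm n) (HolGerm n) :=
  Derivation.mk'
    (b.germCoeff i ∘ₗ (Θ.toLinearMap.restrictScalars ℂ) ∘ₗ
      (Algebra.TensorProduct.includeRight : HolGerm n →ₐ[ℂ] A ⊗[ℂ] HolGerm n).toLinearMap)
    (fun g h => by
      have e : (1 : A) ⊗ₜ[ℂ] (g * h) = (1 ⊗ₜ g) * (1 ⊗ₜ h) := by simp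
      simp only [LinearMap.comp_apply, LinearMap.coe_restrictScalars, AlgHom.toLinearMap_apply,
        Algebra.TensorProduct.includeRight_apply, Derivation.coeFn_coe]
      rw [e, Derivation.leibniz, smul_eq_mul, smul_eq_mul, map_add, germCoeff_mul, germCoeff_mul]
      simp [restrictFun_tmul, germCoeff_tmul, b.coeff_one])

theorem derCoeff_apply (i : ι) (Θ : Derivation A (A ⊗[ℂ] HolGerm n) (A ⊗[ℂ] HolGerm n))
    (g : HolGerm n) : b.derCoeff i Θ g = b.germCoeff i (Θ (1 ⊗ₜ g)) := rfl

theorem germCoeff_derivation_germMk (Θ : Derivation A (A ⊗[ℂ] HolGerm n) (A ⊗[ℂ] HolGerm n))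
    (h : HolGerm n) (g : ι → HolGerm n) (i : ι) :
    b.germCoeff i (Θ (b.germMk h g)) = b.derCoeff i Θ h + restrictDer π Θ (g i) := by
  rw [germMk, map_add, map_add, map_sum, map_sum, derCoeff_apply]
  congr 1
  rw [Finset.sum_congr rfl fun j _ => by rw [derivation_tmul, germCoeff_gen_smul],
    Finset.sum_ite_eq, if_pos (Finset.mem_univ i), restrictDer_apply]

theorem derivation_ext {Θ Θ' : Derivation A (A ⊗[ℂ] HolGerm n) (A ⊗[ℂ] HolGerm n)}
    (h : ∀ g, restrictDer π Θ g = restrictDer π Θ' g)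
    (h' : ∀ i g, b.derCoeff i Θ g = b.derCoeff i Θ' g) : Θ = Θ' := by
  ext z
  induction z using TensorProduct.induction_on with
  | zero => simp
  | add z z' hz hz' => simp only [map_add, hz, hz']
  | tmul a g =>
    rw [derivation_tmul, derivation_tmul Θ']
    congr 1
    exact b.germ_ext (h g) fun i => h' i g

/-- The relative vector field `θ + ∑ ηᵢ εᵢ`. -/
def derMk (θ : Derivation ℂ (HolGerm n) (HolGerm n))
    (η : ι → Derivation ℂ (HolGerm n) (HolGerm n)) :
    Derivation A (A ⊗[ℂ] HolGerm n) (A ⊗[ℂ] HolGerm n) :=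
  baseChangeDer A θ + ∑ i, (algebraMap A (A ⊗[ℂ] HolGerm n) (b.gen i)) • baseChangeDer A (η i)

theorem derMk_one_tmul (θ : Derivation ℂ (HolGerm n) (HolGerm n))
    (η : ι → Derivation ℂ (HolGerm n) (HolGerm n)) (g : HolGerm n) :
    b.derMk θ η (1 ⊗ₜ g) = b.germMk (θ g) fun i => η i g := by
  have hs : ∀ s : Finset ι, (∑ i ∈ s, (algebraMap A (A ⊗[ℂ] HolGerm n) (b.gen i)) •
      baseChangeDer A (η i)) (1 ⊗ₜ g) = ∑ i ∈ s, b.gen i ⊗ₜ η i g := by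
    intro s
    induction s using Finset.cons_induction with
    | empty => rfl
    | cons i s hi ih =>
      rw [Finset.sum_cons, Finset.sum_cons, Derivation.add_apply, ih, Derivation.smul_apply,
        baseChangeDer_tmul, Algebra.TensorProduct.algebraMap_apply, smul_eq_mul,
        Algebra.TensorProduct.tmul_mul_tmul, one_mul, mul_one, Algebra.algebraMap_self_apply]
  rw [derMk, Derivation.add_apply, hs, baseChangeDer_tmul, germMk]

theorem restrictDer_derMk (θ : Derivation ℂ (HolGerm n) (HolGerm n))
    (η : ι → Derivation ℂ (HolGerm n) (HolGerm n)) : restrictDer π (b.derMk θ η) = θ := by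
  ext1 g
  rw [restrictDer_apply, derMk_one_tmul, restrictFun_germMk]

theorem derCoeff_derMk (θ : Derivation ℂ (HolGerm n) (HolGerm n))
    (η : ι → Derivation ℂ (HolGerm n) (HolGerm n)) (i : ι) :
    b.derCoeff i (b.derMk θ η) = η i := by
  ext1 g
  rw [derCoeff_apply, derMk_one_tmul, germCoeff_germMk]

/-- The Leibniz rule reduces the test to the generator; the rest is comparison of coefficients. -/
theorem mem_logDer_span_germMk_iff {f : HolGerm n} {g : ι → HolGerm n}
    {Θ : Derivation A (A ⊗[ℂ] HolGerm n) (A ⊗[ℂ] HolGerm n)} :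
    Θ ∈ logDer A (Ideal.span {b.germMk f g}) ↔ ∃ (u : HolGerm n) (v : ι → HolGerm n),
      restrictDer π Θ f = u * f ∧
        ∀ i, b.derCoeff i Θ f + restrictDer π Θ (g i) = u * g i + v i * f := by
  have h : Θ ∈ logDer A (Ideal.span {b.germMk f g}) ↔
      Θ (b.germMk f g) ∈ Ideal.span {b.germMk f g} := by
    refine ⟨fun h => h _ (Ideal.mem_span_singleton_self _), fun h z hz => ?_⟩
    obtain ⟨c, rfl⟩ := Ideal.mem_span_singleton'.mp hz
    rw [Derivation.leibniz, smul_eq_mul, smul_eq_mul]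
    exact add_mem (Ideal.mul_mem_left _ _ h) (Ideal.mul_mem_right _ _
      (Ideal.mem_span_singleton_self _))
  rw [h, mem_span_germMk_iff, restrictFun_derivation, restrictFun_germMk]
  simp only [germCoeff_derivation_germMk]

theorem mem_logDer_span_iff {f : HolGerm n} {θ : Derivation ℂ (HolGerm n) (HolGerm n)} :
    θ ∈ logDer ℂ (Ideal.span {f}) ↔ ∃ α, θ f = α * f := by
  refine ⟨fun h => ?_, fun ⟨α, h⟩ z hz => ?_⟩
  · obtain ⟨α, hα⟩ := Ideal.mem_span_singleton'.mp (h f (Ideal.mem_span_singleton_self _))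
    exact ⟨α, hα.symm⟩
  · obtain ⟨c, rfl⟩ := Ideal.mem_span_singleton'.mp hz
    rw [Derivation.leibniz, smul_eq_mul, smul_eq_mul, h]
    exact Ideal.mem_span_singleton'.mpr ⟨c * α + θ c, by ring⟩

end FirstOrderBasis

end Lifting

/-! ### Admissibility of first order deformations -/

section PlaneCurve

open FirstOrderBasis

variable {A : Type} [CommRing A] [Algebra ℂ A] {ι : Type} [Fintype ι] [DecidableEq ι]
  {π : A →ₐ[ℂ] ℂ} (b : FirstOrderBasis π ι) {f : MvPolynomial (Fin 2) ℂ}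

theorem exists_derivation_eq_of_mem_jacobianGerm {g : HolGerm 2} (hg : g ∈ jacobianGerm f) :
    ∃ η : Derivation ℂ (HolGerm 2) (HolGerm 2), η (polyGerm 2 f) = g := by
  obtain ⟨a, c, rfl⟩ := mem_map_jacobianIdeal_iff.mp hg
  refine ⟨a • pderivGerm 0 + c • pderivGerm 1, ?_⟩
  rw [derivation_polyGerm, Fin.sum_univ_two]
  simp [pderivGerm_coord]

/-- The obstruction `θ gᵢ - α gᵢ` lies in the Jacobian ideal, so it equals `ηᵢ f` for a field `ηᵢ`,
and `θ - ∑ ηᵢ εᵢ` is logarithmic. -/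
theorem exists_lift {g : ι → HolGerm 2} (hg : ∀ i, g i ∈ admissibleGerms f)
    {θ : Derivation ℂ (HolGerm 2) (HolGerm 2)}
    (hθ : θ ∈ logDer ℂ (Ideal.span {polyGerm 2 f})) :
    ∃ Θ ∈ logDer A (Ideal.span {b.germMk (polyGerm 2 f) g}), restrictDer π Θ = θ := by
  obtain ⟨α, hα⟩ := mem_logDer_span_iff.mp hθ
  choose η hη using fun i => exists_derivation_eq_of_mem_jacobianGerm (hg i θ α hα)
  refine ⟨b.derMk θ fun i => -η i, ?_, b.restrictDer_derMk _ _⟩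
  rw [mem_logDer_span_germMk_iff]
  refine ⟨α, 0, ?_, fun i => ?_⟩
  · rw [restrictDer_derMk, hα]
  · rw [restrictDer_derMk, derCoeff_derMk, Derivation.neg_apply, hη]
    simp

/-- The deformation `f + ∑ gᵢ εᵢ`. -/
def deformationMk (hf : polyGerm 2 f ≠ 0) {g : ι → HolGerm 2}
    (hg : ∀ i, g i ∈ admissibleGerms f) : AdmissibleDeformation (polyGerm 2 f) π where
  ideal := Ideal.span {b.germMk (polyGerm 2 f) g}
  flat := b.flat_quotient_span_germMk hf g
  centralFibre := b.map_span_germMk _ g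
  restrict_image := by
    ext θ
    constructor
    · rintro ⟨Θ, hΘ, rfl⟩
      obtain ⟨u, -, hu, -⟩ := b.mem_logDer_span_germMk_iff.mp hΘ
      exact mem_logDer_span_iff.mpr ⟨u, hu⟩
    · exact exists_lift b hg
  restrict_kernel Θ hΘ := by
    constructor
    -- With zero restriction, `u f = 0` gives `u = 0`, so each `εᵢ`-coefficient is itself
    -- logarithmic for `f`. Lifting these coefficients to `Θ' i` gives `Θ = ∑ εᵢ Θ' i`, as only the
    -- restriction of `Θ' i` matters after multiplication by `εᵢ`.
    · intro h0
      obtain ⟨u, v, hu, hv⟩ := b.mem_logDer_span_germMk_iff.mp hΘ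
      rw [h0, Derivation.zero_apply, eq_comm, mul_eq_zero, or_iff_left hf] at hu
      have hη : ∀ i, b.derCoeff i Θ ∈ logDer ℂ (Ideal.span {polyGerm 2 f}) := fun i => by
        refine mem_logDer_span_iff.mpr ⟨v i, ?_⟩
        have := hv i
        rwa [h0, Derivation.zero_apply, hu, zero_mul, zero_add, add_zero] at this
      choose Θ' hΘ' hr using fun i => exists_lift b hg (hη i)
      have hsum : Θ = ∑ i, algebraMap A (A ⊗[ℂ] HolGerm 2) (b.gen i) • Θ' i := by
        have happ : ∀ (s : Finset ι) (z : A ⊗[ℂ] HolGerm 2),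
            (∑ i ∈ s, algebraMap A (A ⊗[ℂ] HolGerm 2) (b.gen i) • Θ' i) z =
              ∑ i ∈ s, b.gen i • Θ' i z := by
          intro s z
          induction s using Finset.cons_induction with
          | empty => rfl
          | cons i s hi ih =>
            rw [Finset.sum_cons, Finset.sum_cons, Derivation.add_apply, ih, Derivation.smul_apply,
              smul_eq_mul, ← Algebra.smul_def]
        refine b.derivation_ext (fun g => ?_) fun i g => ?_
        · rw [h0, restrictDer_apply, happ, map_sum]
          refine (Finset.sum_eq_zero fun i _ => ?_).symm
          rw [restrictFun_smul, b.map_gen, zero_smul]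
        · refine Eq.symm ?_
          rw [derCoeff_apply, happ, map_sum,
            Finset.sum_congr rfl fun j _ => b.germCoeff_gen_smul i j _, Finset.sum_ite_eq,
            if_pos (Finset.mem_univ i), ← restrictDer_apply, hr]
      rw [hsum]
      refine sum_mem fun i _ => Submodule.smul_mem_smul (Ideal.mem_map_of_mem _ ?_) (hΘ' i)
      exact b.map_gen i
    · intro h
      clear hΘ
      induction h using Submodule.smul_induction_on' with
      | smul r hr Θ' hΘ' =>
        ext1 g
        have hr0 : restrictFun 2 π r = 0 := by
          have : (RingHom.ker π).map (algebraMap A (A ⊗[ℂ] HolGerm 2)) ≤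
              RingHom.ker (restrictFun 2 π) := by
            rw [Ideal.map_le_iff_le_comap]
            intro a ha
            rw [Ideal.mem_comap, RingHom.mem_ker, Algebra.TensorProduct.algebraMap_apply,
              restrictFun_tmul]
            change π a • _ = _
            rw [(RingHom.mem_ker).mp ha, zero_smul]
          exact this hr
        rw [restrictDer_apply, Derivation.smul_apply, smul_eq_mul, map_mul, hr0, zero_mul]
        rfl
      | add Θ₁ h₁ Θ₂ h₂ e₁ e₂ =>
        ext1 g
        have e₁' := congrArg (fun θ : Derivation ℂ (HolGerm 2) (HolGerm 2) => θ g) e₁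
        have e₂' := congrArg (fun θ : Derivation ℂ (HolGerm 2) (HolGerm 2) => θ g) e₂
        simp only [restrictDer_apply, Derivation.add_apply, map_add] at e₁' e₂' ⊢
        rw [e₁', e₂']
        simp

/-- A lift of `θ` expresses `θ gᵢ - α gᵢ` as `vᵢ f - ηᵢ f`; both terms are in the Jacobian ideal,
the first by `hfJ`. -/
theorem exists_ideal_eq_span_germMk (h0 : polyGerm 2 f ≠ 0)
    (hfJ : polyGerm 2 f ∈ jacobianGerm f)
    (X : AdmissibleDeformation (polyGerm 2 f) π) :
    ∃ g : ι → HolGerm 2, (∀ i, g i ∈ admissibleGerms f) ∧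
      X.ideal = Ideal.span {b.germMk (polyGerm 2 f) g} := by
  obtain ⟨g, hg⟩ := b.exists_eq_span_germMk X.flat X.centralFibre
  refine ⟨g, fun i θ α hθ => ?_, hg⟩
  have h : θ ∈ restrictDer π '' (logDer A X.ideal : Set _) := by
    rw [X.restrict_image]
    exact mem_logDer_span_iff.mpr ⟨α, hθ⟩
  obtain ⟨Θ, hΘ, rfl⟩ := h
  rw [hg] at hΘ
  obtain ⟨u, v, hu, hv⟩ := b.mem_logDer_span_germMk_iff.mp hΘ
  have hα : u = α := mul_right_cancel₀ h0 (hu.symm.trans hθ)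
  have h1 : restrictDer π Θ (g i) - α * g i =
      v i * polyGerm 2 f - b.derCoeff i Θ (polyGerm 2 f) := by
    have := hv i
    rw [hα] at this
    linear_combination this
  rw [h1]
  exact sub_mem (Ideal.mul_mem_left _ _ hfJ) (derivation_polyGerm_mem _)

end PlaneCurve

/-! ### Isomorphisms of first order deformations -/

section Isomorphism

variable {n : ℕ} {A : Type} [CommRing A] [Algebra ℂ A] {ι : Type} [Fintype ι] [DecidableEq ι]
  {π : A →ₐ[ℂ] ℂ}

namespace FirstOrderBasis

variable (b : FirstOrderBasis π ι)

theorem germMk_zero_right (h : HolGerm n) : b.germMk h 0 = 1 ⊗ₜ h := by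
  simp [germMk]

/-- The ring homomorphism `h ↦ h + ∑ Dᵢ(h) εᵢ`. -/
def expGerm (D : ι → Derivation ℂ (HolGerm n) (HolGerm n)) : HolGerm n →ₐ[ℂ] A ⊗[ℂ] HolGerm n where
  toFun h := b.germMk h fun i => D i h
  map_one' := by
    simp only [Derivation.map_one_eq_zero]
    exact b.germMk_zero_right 1
  map_zero' := by
    simp only [map_zero]
    exact (b.germMk_zero_right 0).trans (TensorProduct.tmul_zero _ _)
  map_mul' g h := by
    rw [germMk_mul]
    simp only [Derivation.leibniz, smul_eq_mul]
  map_add' g h := by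
    rw [germMk_add]
    simp only [map_add]
  commutes' c := by
    simp only [Derivation.map_algebraMap]
    refine (b.germMk_zero_right _).trans ?_
    rw [Algebra.algebraMap_eq_smul_one, TensorProduct.tmul_smul, Algebra.algebraMap_eq_smul_one]
    rfl

theorem expGerm_apply (D : ι → Derivation ℂ (HolGerm n) (HolGerm n)) (h : HolGerm n) :
    b.expGerm D h = b.germMk h fun i => D i h := rfl

theorem germMk_add_sum_smul (h : HolGerm n) (d g : ι → HolGerm n) (d' : ι → ι → HolGerm n) :
    b.germMk h d + ∑ i, b.gen i • b.germMk (g i) (d' i) = b.germMk h fun i => d i + g i := by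
  refine b.germ_ext ?_ fun i => ?_
  · rw [map_add, map_sum, restrictFun_germMk, restrictFun_germMk, Finset.sum_eq_zero, add_zero]
    intro i _
    rw [restrictFun_smul, b.map_gen, zero_smul]
  · rw [map_add, map_sum, germCoeff_germMk, germCoeff_germMk,
      Finset.sum_congr rfl fun j _ => b.germCoeff_gen_smul i j _, Finset.sum_ite_eq,
      if_pos (Finset.mem_univ i), restrictFun_germMk]

/-- The `A`-algebra homomorphism extending `h ↦ h + ∑ Dᵢ(h) εᵢ`. -/
def expHom (D : ι → Derivation ℂ (HolGerm n) (HolGerm n)) :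
    A ⊗[ℂ] HolGerm n →ₐ[A] A ⊗[ℂ] HolGerm n :=
  Algebra.TensorProduct.lift (Algebra.ofId A _) (b.expGerm D) fun _ _ => Commute.all _ _

theorem expHom_germMk (D : ι → Derivation ℂ (HolGerm n) (HolGerm n)) (h : HolGerm n)
    (g : ι → HolGerm n) :
    b.expHom D (b.germMk h g) = b.germMk h fun i => D i h + g i := by
  have h1 : ∀ (a : A) (x : HolGerm n),
      b.expHom D (a ⊗ₜ x) = a • b.germMk x fun i => D i x := fun a x => by
    rw [expHom, Algebra.TensorProduct.lift_tmul, expGerm_apply, Algebra.ofId_apply,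
      ← Algebra.smul_def]
  conv_lhs => rw [germMk]
  rw [map_add, map_sum, h1, one_smul, Finset.sum_congr rfl fun i _ => h1 (b.gen i) (g i),
    germMk_add_sum_smul]

/-- Products of the `εᵢ` vanish, so the exponential of `D` is `1 + D` and its inverse is `1 - D`. -/
theorem expHom_comp_neg (D : ι → Derivation ℂ (HolGerm n) (HolGerm n)) :
    (b.expHom D).comp (b.expHom fun i => -D i) = AlgHom.id A _ := by
  refine AlgHom.ext fun z => ?_
  rw [← b.germMk_eq z, AlgHom.comp_apply, expHom_germMk, expHom_germMk]
  simp

/-- The automorphism of `ℂⁿ × S` given by `h ↦ h + ∑ Dᵢ(h) εᵢ`. -/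
def expEquiv (D : ι → Derivation ℂ (HolGerm n) (HolGerm n)) :
    A ⊗[ℂ] HolGerm n ≃ₐ[A] A ⊗[ℂ] HolGerm n :=
  AlgEquiv.ofAlgHom (b.expHom D) (b.expHom fun i => -D i) (b.expHom_comp_neg D)
    (by
      have h : (fun i => - -D i) = D := funext fun i => Derivation.ext fun x => neg_neg (D i x)
      have h' := b.expHom_comp_neg fun i => -D i
      rwa [h] at h')

theorem expEquiv_germMk (D : ι → Derivation ℂ (HolGerm n) (HolGerm n)) (h : HolGerm n)
    (g : ι → HolGerm n) :
    b.expEquiv D (b.germMk h g) = b.germMk h fun i => D i h + g i :=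
  b.expHom_germMk D h g

theorem restrictFun_expEquiv (D : ι → Derivation ℂ (HolGerm n) (HolGerm n))
    (z : A ⊗[ℂ] HolGerm n) : restrictFun n π (b.expEquiv D z) = restrictFun n π z := by
  rw [← b.germMk_eq z, expEquiv_germMk, restrictFun_germMk, restrictFun_germMk]

theorem isIsomorphic_of_derivation {f : HolGerm n} {X Y : AdmissibleDeformation f π}
    {g g' : ι → HolGerm n} (hX : X.ideal = Ideal.span {b.germMk f g})
    (hY : Y.ideal = Ideal.span {b.germMk f g'})
    (D : ι → Derivation ℂ (HolGerm n) (HolGerm n)) (hD : ∀ i, D i f + g i = g' i) :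
    X.IsIsomorphic Y := by
  have h : Y.ideal = X.ideal.map (b.expEquiv D : A ⊗[ℂ] HolGerm n →+* A ⊗[ℂ] HolGerm n) := by
    rw [hX, hY, Ideal.map_span, Set.image_singleton]
    change _ = Ideal.span {b.expEquiv D _}
    rw [expEquiv_germMk]
    simp only [hD]
  refine ⟨Ideal.quotientEquivAlg X.ideal Y.ideal (b.expEquiv D) h, fun z => ?_⟩
  obtain ⟨z, rfl⟩ := Ideal.Quotient.mk_surjective z
  change Ideal.Quotient.mk _ (restrictFun n π (b.expEquiv D z)) =
    Ideal.Quotient.mk _ (restrictFun n π z)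
  rw [restrictFun_expEquiv]

/-- An arbitrary representative restricts to `h` only modulo `f`; subtracting a multiple of the
generator of `Y.ideal` corrects this. -/
theorem exists_isomorphism_one_tmul {f : HolGerm n} {X Y : AdmissibleDeformation f π}
    {g' : ι → HolGerm n} (hY : Y.ideal = Ideal.span {b.germMk f g'})
    {τ : ((A ⊗[ℂ] HolGerm n) ⧸ X.ideal) ≃ₐ[A] ((A ⊗[ℂ] HolGerm n) ⧸ Y.ideal)}
    (hτ : ∀ z, Y.toFibre (τ z) = X.toFibre z) (h : HolGerm n) : ∃ d : ι → HolGerm n,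
      τ (Ideal.Quotient.mkₐ A X.ideal (1 ⊗ₜ h)) =
        Ideal.Quotient.mkₐ A Y.ideal (b.germMk h d) := by
  obtain ⟨z, hz⟩ := Ideal.Quotient.mk_surjective (τ (Ideal.Quotient.mkₐ A X.ideal (1 ⊗ₜ h)))
  have h1 := hτ (Ideal.Quotient.mkₐ A X.ideal (1 ⊗ₜ h))
  rw [← hz] at h1
  change Ideal.Quotient.mk _ (restrictFun n π z) =
    Ideal.Quotient.mk _ (restrictFun n π (1 ⊗ₜ h)) at h1
  rw [restrictFun_tmul, map_one, one_smul, Ideal.Quotient.eq, Ideal.mem_span_singleton'] at h1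
  obtain ⟨u, hu⟩ := h1
  set z' := z - b.germMk u 0 * b.germMk f g' with hz'
  have hr : restrictFun n π z' = h := by
    rw [hz', map_sub, map_mul, restrictFun_germMk, restrictFun_germMk, hu, sub_sub_cancel]
  refine ⟨fun i => b.germCoeff i z', ?_⟩
  rw [← hz]
  conv_rhs => rw [← hr, b.germMk_eq]
  refine Ideal.Quotient.eq.mpr ?_
  rw [hz', sub_sub_cancel, hY]
  exact Ideal.mul_mem_left _ _ (Ideal.mem_span_singleton_self _)

end FirstOrderBasis

section PlaneCurve

open FirstOrderBasis

variable (b : FirstOrderBasis π ι) {f : MvPolynomial (Fin 2) ℂ}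
  {X Y : AdmissibleDeformation (polyGerm 2 f) π} {g g' : ι → HolGerm 2}

theorem isIsomorphic_of_sub_mem (hX : X.ideal = Ideal.span {b.germMk (polyGerm 2 f) g})
    (hY : Y.ideal = Ideal.span {b.germMk (polyGerm 2 f) g'})
    (h : ∀ i, g' i - g i ∈ jacobianGerm f) : X.IsIsomorphic Y := by
  choose D hD using fun i => exists_derivation_eq_of_mem_jacobianGerm (h i)
  exact b.isIsomorphic_of_derivation hX hY D fun i => by rw [hD, sub_add_cancel]

/-- The isomorphism lives on the quotients and `d` is merely a choice of representatives. As `f` is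
a polynomial, `τ` on it is determined by the coordinates, where `d` agrees with genuine derivations
`D i`. Applying `τ` to the generator of `X.ideal` gives `D i f + g i = g' i + v i f`. -/
theorem sub_mem_of_isIsomorphic (h0 : polyGerm 2 f ≠ 0) (hfJ : polyGerm 2 f ∈ jacobianGerm f)
    (hX : X.ideal = Ideal.span {b.germMk (polyGerm 2 f) g})
    (hY : Y.ideal = Ideal.span {b.germMk (polyGerm 2 f) g'})
    (h : X.IsIsomorphic Y) (i : ι) : g' i - g i ∈ jacobianGerm f := by
  obtain ⟨τ, hτ⟩ := h
  choose d hd using b.exists_isomorphism_one_tmul hY hτ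
  -- The derivations with the values of `d` on the two coordinates.
  let D : ι → Derivation ℂ (HolGerm 2) (HolGerm 2) := fun i =>
    d (coord 0) i • pderivGerm 0 + d (coord 1) i • pderivGerm 1
  have hD : ∀ j i, D i (coord j) = d (coord j) i := by
    rw [Fin.forall_fin_two]
    constructor <;> intro i <;> simp [D, pderivGerm_coord]
  let φ : MvPolynomial (Fin 2) ℂ →ₐ[ℂ] (A ⊗[ℂ] HolGerm 2) ⧸ Y.ideal :=
    (τ.toAlgHom.restrictScalars ℂ).comp (((Ideal.Quotient.mkₐ A X.ideal).restrictScalars ℂ).comp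
      (Algebra.TensorProduct.includeRight.comp (polyGerm 2)))
  let ψ : MvPolynomial (Fin 2) ℂ →ₐ[ℂ] (A ⊗[ℂ] HolGerm 2) ⧸ Y.ideal :=
    ((Ideal.Quotient.mkₐ A Y.ideal).restrictScalars ℂ).comp ((b.expGerm D).comp (polyGerm 2))
  have hφψ : φ = ψ := by
    refine MvPolynomial.algHom_ext fun j => ?_
    change τ (Ideal.Quotient.mkₐ A X.ideal (1 ⊗ₜ polyGerm 2 (MvPolynomial.X j))) =
      Ideal.Quotient.mkₐ A Y.ideal (b.germMk (polyGerm 2 (MvPolynomial.X j))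
        fun i => D i (polyGerm 2 (MvPolynomial.X j)))
    rw [show polyGerm 2 (MvPolynomial.X j) = coord j from MvPolynomial.aeval_X _ _, hd]
    simp only [hD]
  have hF : τ (Ideal.Quotient.mkₐ A X.ideal (1 ⊗ₜ polyGerm 2 f)) =
      Ideal.Quotient.mkₐ A Y.ideal (b.germMk (polyGerm 2 f) fun i => D i (polyGerm 2 f)) :=
    congrArg (fun χ => χ f) hφψ
  have hmem : b.germMk (polyGerm 2 f) g ∈ X.ideal := by
    rw [hX]; exact Ideal.mem_span_singleton_self _
  have hz : Ideal.Quotient.mkₐ A X.ideal (b.germMk (polyGerm 2 f) g) = 0 :=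
    Ideal.Quotient.eq_zero_iff_mem.mpr hmem
  have hsplit : b.germMk (polyGerm 2 f) g =
      1 ⊗ₜ polyGerm 2 f + ∑ i, b.gen i • ((1 : A) ⊗ₜ[ℂ] g i) := by
    simp only [germMk, TensorProduct.smul_tmul', smul_eq_mul, mul_one]
  rw [hsplit, map_add, map_sum] at hz
  have hz2 := congrArg τ hz
  rw [map_add, map_sum, map_zero, hF] at hz2
  have hgen : ∀ i, τ (Ideal.Quotient.mkₐ A X.ideal (b.gen i • ((1 : A) ⊗ₜ[ℂ] g i))) =
      Ideal.Quotient.mkₐ A Y.ideal (b.gen i • b.germMk (g i) (d (g i))) := fun i => by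
    rw [map_smul, map_smul, hd, map_smul]
  rw [Finset.sum_congr rfl fun i _ => hgen i, ← map_sum, ← map_add, germMk_add_sum_smul] at hz2
  have hz3 := Ideal.Quotient.eq_zero_iff_mem.mp hz2
  rw [hY, mem_span_germMk_iff, restrictFun_germMk] at hz3
  obtain ⟨u, v, hu, hv⟩ := hz3
  -- The central fibre gives `f = u f`.
  have hu1 : u = 1 := mul_right_cancel₀ h0 (hu.symm.trans (one_mul _).symm)
  have := hv i
  rw [germCoeff_germMk, hu1, one_mul] at this
  have e : g' i - g i = D i (polyGerm 2 f) - v i * polyGerm 2 f := by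
    linear_combination -this
  rw [e]
  exact sub_mem (derivation_polyGerm_mem _) (Ideal.mul_mem_left _ _ hfJ)

end PlaneCurve

end Isomorphism

/-! ### Base change in coordinates -/

section BaseChange

variable {n : ℕ} {A B : Type} [CommRing A] [Algebra ℂ A] [CommRing B] [Algebra ℂ B]
  {ι κ : Type} [Fintype ι] [DecidableEq ι] [Fintype κ] [DecidableEq κ]
  {π : A →ₐ[ℂ] ℂ} {ρ : B →ₐ[ℂ] ℂ}

theorem map_germMk (b : FirstOrderBasis π ι) (b' : FirstOrderBasis ρ κ) (φ : A →ₐ[ℂ] B)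
    (hφ : ∀ i, ρ (φ (b.gen i)) = 0) (f : HolGerm n) (g : ι → HolGerm n) :
    Algebra.TensorProduct.map φ (AlgHom.id ℂ (HolGerm n)) (b.germMk f g) =
      b'.germMk f fun j => ∑ i, b'.coeff j (φ (b.gen i)) • g i := by
  refine b'.germ_ext ?_ fun j => ?_
  · rw [FirstOrderBasis.restrictFun_germMk]
    simp [FirstOrderBasis.germMk, restrictFun_tmul, hφ]
  · rw [FirstOrderBasis.germCoeff_germMk]
    simp [FirstOrderBasis.germMk, FirstOrderBasis.germCoeff_tmul, b'.coeff_one]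

theorem isBaseChange_iff (b : FirstOrderBasis π ι) (b' : FirstOrderBasis ρ κ) (φ : A →ₐ[ℂ] B)
    (hφ : ∀ i, ρ (φ (b.gen i)) = 0) {f : HolGerm n} {g : ι → HolGerm n}
    {X : AdmissibleDeformation f π} (hX : X.ideal = Ideal.span {b.germMk f g})
    (Y : AdmissibleDeformation f ρ) : AdmissibleDeformation.IsBaseChange φ X Y ↔
      Y.ideal = Ideal.span {b'.germMk f fun j => ∑ i, b'.coeff j (φ (b.gen i)) • g i} := by
  rw [AdmissibleDeformation.IsBaseChange, hX, Ideal.map_span, Set.image_singleton,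
    map_germMk b b' φ hφ]

/-- The first order basis of `ℂ ⊕ M` given by a basis of `M`. -/
def trivSqZeroExtBasis {M : Type} [AddCommGroup M] [Module ℂ M] [Module ℂᵐᵒᵖ M]
    [IsCentralScalar ℂ M] (B : Module.Basis ι ℂ M) :
    FirstOrderBasis (TrivSqZeroExt.fstHom ℂ ℂ M) ι where
  gen i := TrivSqZeroExt.inr (B i)
  coeff i := (B.coord i) ∘ₗ (TrivSqZeroExt.sndHom ℂ M)
  map_gen i := rfl
  gen_mul_gen i j := TrivSqZeroExt.inr_mul_inr ℂ _ _
  coeff_gen i j := by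
    simp [Finsupp.single_apply, eq_comm]
  eq_sum a := by
    have h : ∑ i, (B.coord i ∘ₗ TrivSqZeroExt.sndHom ℂ M) a • TrivSqZeroExt.inr (R := ℂ) (B i) =
        TrivSqZeroExt.inr a.snd := by
      conv_rhs => rw [← B.sum_repr a.snd]
      rw [← TrivSqZeroExt.inrHom_apply ℂ M, map_sum]
      simp
    rw [h, TrivSqZeroExt.algebraMap_eq_inl]
    exact (TrivSqZeroExt.inl_fst_add_inr_snd_eq a).symm

theorem isBaseChange_map_iff {M N : Type} [AddCommGroup M] [Module ℂ M] [Module ℂᵐᵒᵖ M]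
    [IsCentralScalar ℂ M] [AddCommGroup N] [Module ℂ N] [Module ℂᵐᵒᵖ N] [IsCentralScalar ℂ N]
    (B : Module.Basis ι ℂ M) (B' : Module.Basis κ ℂ N) (l : M →ₗ[ℂ] N) {f : HolGerm n}
    {g : ι → HolGerm n} {X : AdmissibleDeformation f (TrivSqZeroExt.fstHom ℂ ℂ M)}
    (hX : X.ideal = Ideal.span {(trivSqZeroExtBasis B).germMk f g})
    (Y : AdmissibleDeformation f (TrivSqZeroExt.fstHom ℂ ℂ N)) :
    AdmissibleDeformation.IsBaseChange (TrivSqZeroExt.map l) X Y ↔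
      Y.ideal = Ideal.span
        {(trivSqZeroExtBasis B').germMk f fun j => ∑ i, B'.repr (l (B i)) j • g i} := by
  rw [isBaseChange_iff (trivSqZeroExtBasis B) (trivSqZeroExtBasis B') _ _ hX]
  · have : ∀ i j, (trivSqZeroExtBasis B').coeff j (TrivSqZeroExt.map l
        ((trivSqZeroExtBasis B).gen i)) = B'.repr (l (B i)) j := fun i j => by
      simp [trivSqZeroExtBasis]
    simp only [this]
  · intro i
    simp [trivSqZeroExtBasis]

end BaseChange

/-! ### Identification of the tangent space and its operations -/

section Tangent

variable {f : MvPolynomial (Fin 2) ℂ}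

/-- The basis `ε` of the maximal ideal of `ℂ[ε]`. -/
abbrev dualBasis : FirstOrderBasis (TrivSqZeroExt.fstHom ℂ ℂ ℂ) Unit :=
  trivSqZeroExtBasis (Module.Basis.singleton Unit ℂ)

/-- The basis `ε₁, ε₂` of the maximal ideal of `ℂ[ε₁, ε₂]/(ε₁, ε₂)²`. -/
abbrev dualProdBasis : FirstOrderBasis (TrivSqZeroExt.fstHom ℂ ℂ (ℂ × ℂ)) (Fin 2) :=
  trivSqZeroExtBasis (Module.Basis.finTwoProd ℂ)

theorem exists_dualBasis_ideal_eq (h0 : polyGerm 2 f ≠ 0) (hfJ : polyGerm 2 f ∈ jacobianGerm f)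
    (X : AdmissibleDeformation (polyGerm 2 f) (TrivSqZeroExt.fstHom ℂ ℂ ℂ)) :
    ∃ g : admissibleGerms f,
      X.ideal = Ideal.span {dualBasis.germMk (polyGerm 2 f) fun _ => g.1} := by
  obtain ⟨g, hg, h⟩ := exists_ideal_eq_span_germMk dualBasis h0 hfJ X
  exact ⟨⟨g (), hg ()⟩, h⟩

/-- The class in the tangent space of a first order deformation. -/
def tangentClass (h0 : polyGerm 2 f ≠ 0) (hfJ : polyGerm 2 f ∈ jacobianGerm f) :
    FT1 (polyGerm 2 f) → AdmissibleTangent f :=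
  Quotient.lift (fun X => Submodule.Quotient.mk (exists_dualBasis_ideal_eq h0 hfJ X).choose)
    fun X Y h => by
      refine ((Submodule.Quotient.eq _).mpr ?_).symm
      exact sub_mem_of_isIsomorphic dualBasis h0 hfJ
        (exists_dualBasis_ideal_eq h0 hfJ X).choose_spec
        (exists_dualBasis_ideal_eq h0 hfJ Y).choose_spec h ()

theorem tangentClass_mk (h0 : polyGerm 2 f ≠ 0) (hfJ : polyGerm 2 f ∈ jacobianGerm f)
    {X : AdmissibleDeformation (polyGerm 2 f) (TrivSqZeroExt.fstHom ℂ ℂ ℂ)}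
    {g : admissibleGerms f}
    (hX : X.ideal = Ideal.span {dualBasis.germMk (polyGerm 2 f) fun _ => g.1}) :
    tangentClass h0 hfJ (Quotient.mk _ X) = Submodule.Quotient.mk g := by
  refine ((Submodule.Quotient.eq _).mpr ?_).symm
  exact sub_mem_of_isIsomorphic dualBasis h0 hfJ
    (exists_dualBasis_ideal_eq h0 hfJ X).choose_spec hX
    ((AdmissibleDeformation.setoid _ _).refl X) ()

/-- The first order deformation `f + ε g`. -/
def dualDeformation (h0 : polyGerm 2 f ≠ 0) (g : admissibleGerms f) :
    AdmissibleDeformation (polyGerm 2 f) (TrivSqZeroExt.fstHom ℂ ℂ ℂ) :=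
  deformationMk dualBasis h0 (g := fun _ => g.1) fun _ => g.2

theorem tangentClass_dualDeformation (h0 : polyGerm 2 f ≠ 0)
    (hfJ : polyGerm 2 f ∈ jacobianGerm f) (g : admissibleGerms f) :
    tangentClass h0 hfJ (Quotient.mk _ (dualDeformation h0 g)) = Submodule.Quotient.mk g :=
  tangentClass_mk h0 hfJ rfl

theorem tangentClass_bijective (h0 : polyGerm 2 f ≠ 0) (hfJ : polyGerm 2 f ∈ jacobianGerm f) :
    Function.Bijective (tangentClass h0 hfJ) := by
  constructor
  · intro a c h
    induction a using Quotient.inductionOn with | _ X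
    induction c using Quotient.inductionOn with | _ Y
    obtain ⟨g, hg⟩ := exists_dualBasis_ideal_eq h0 hfJ X
    obtain ⟨g', hg'⟩ := exists_dualBasis_ideal_eq h0 hfJ Y
    rw [tangentClass_mk h0 hfJ hg, tangentClass_mk h0 hfJ hg', eq_comm] at h
    have h' : g' - g ∈ ((jacobianGerm f).restrictScalars ℂ).submoduleOf (admissibleGerms f) :=
      (Submodule.Quotient.eq _).mp h
    exact Quotient.sound (isIsomorphic_of_sub_mem dualBasis hg hg' fun _ => h')
  · intro t
    obtain ⟨g, rfl⟩ := Submodule.Quotient.mk_surjective _ t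
    exact ⟨_, tangentClass_dualDeformation h0 hfJ g⟩

theorem isSMul_iff (h0 : polyGerm 2 f ≠ 0) (hfJ : polyGerm 2 f ∈ jacobianGerm f) (t : ℂ)
    (a c : FT1 (polyGerm 2 f)) :
    FT1.IsSMul t a c ↔ t • tangentClass h0 hfJ a = tangentClass h0 hfJ c := by
  have key : ∀ (X Y : AdmissibleDeformation (polyGerm 2 f) (TrivSqZeroExt.fstHom ℂ ℂ ℂ))
      (g : admissibleGerms f),
      X.ideal = Ideal.span {dualBasis.germMk (polyGerm 2 f) fun _ => g.1} →
      (AdmissibleDeformation.IsBaseChange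
        (TrivSqZeroExt.map (t • (LinearMap.id : ℂ →ₗ[ℂ] ℂ))) X Y ↔
        Y.ideal = Ideal.span {dualBasis.germMk (polyGerm 2 f) fun _ => (t • g).1}) := by
    intro X Y g hX
    rw [isBaseChange_map_iff _ (Module.Basis.singleton Unit ℂ) _ hX]
    simp
  constructor
  · rintro ⟨X, Y, rfl, rfl, h⟩
    obtain ⟨g, hg⟩ := exists_dualBasis_ideal_eq h0 hfJ X
    rw [tangentClass_mk h0 hfJ hg, tangentClass_mk h0 hfJ ((key X Y g hg).mp h)]
    rfl
  · intro h
    obtain ⟨g, hg⟩ := Submodule.Quotient.mk_surjective _ (tangentClass h0 hfJ a)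
    refine ⟨dualDeformation h0 g, dualDeformation h0 (t • g),
      (tangentClass_bijective h0 hfJ).1 ?_, (tangentClass_bijective h0 hfJ).1 ?_,
      (key _ _ g rfl).mpr rfl⟩
    · rw [tangentClass_dualDeformation, hg]
    · rw [tangentClass_dualDeformation, ← h, ← hg]
      rfl

/-- A deformation over the two-parameter base is a pair `(g₀, g₁)`, and base change along a linear
form `l` yields `l(1,0) g₀ + l(0,1) g₁`; the two projections and their sum give `g₀`, `g₁` and `g₀ +
g₁`. -/
theorem isSum_iff (h0 : polyGerm 2 f ≠ 0) (hfJ : polyGerm 2 f ∈ jacobianGerm f)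
    (a b c : FT1 (polyGerm 2 f)) : FT1.IsSum a b c ↔
      tangentClass h0 hfJ a + tangentClass h0 hfJ b = tangentClass h0 hfJ c := by
  have key : ∀ (l : ℂ × ℂ →ₗ[ℂ] ℂ)
      (X : AdmissibleDeformation (polyGerm 2 f) (TrivSqZeroExt.fstHom ℂ ℂ (ℂ × ℂ)))
      (Y : AdmissibleDeformation (polyGerm 2 f) (TrivSqZeroExt.fstHom ℂ ℂ ℂ))
      (g : Fin 2 → admissibleGerms f),
      X.ideal = Ideal.span {dualProdBasis.germMk (polyGerm 2 f) fun i => (g i).1} →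
      (AdmissibleDeformation.IsBaseChange (TrivSqZeroExt.map l) X Y ↔
        Y.ideal = Ideal.span {dualBasis.germMk (polyGerm 2 f)
          fun _ => (l (1, 0) • g 0 + l (0, 1) • g 1).1}) := by
    intro l X Y g hX
    rw [isBaseChange_map_iff _ (Module.Basis.singleton Unit ℂ) _ hX]
    simp
  have hideal : ∀ X : AdmissibleDeformation (polyGerm 2 f) (TrivSqZeroExt.fstHom ℂ ℂ (ℂ × ℂ)),
      ∃ g : Fin 2 → admissibleGerms f,
        X.ideal = Ideal.span {dualProdBasis.germMk (polyGerm 2 f) fun i => (g i).1} := by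
    intro X
    obtain ⟨g, hg, h⟩ := exists_ideal_eq_span_germMk dualProdBasis h0 hfJ X
    exact ⟨fun i => ⟨g i, hg i⟩, h⟩
  constructor
  · rintro ⟨z, ⟨X₁, Y₁, hX₁, rfl, h₁⟩, ⟨X₂, Y₂, hX₂, rfl, h₂⟩, ⟨X₃, Y₃, hX₃, rfl, h₃⟩⟩
    obtain ⟨g₁, hg₁⟩ := hideal X₁
    obtain ⟨g₂, hg₂⟩ := hideal X₂
    obtain ⟨g₃, hg₃⟩ := hideal X₃
    -- The three base changes may use different representatives of the same class; these agree
    -- modulo the Jacobian ideal.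
    have h31 := sub_mem_of_isIsomorphic dualProdBasis h0 hfJ hg₃ hg₁
      (Quotient.exact (hX₃.trans hX₁.symm)) 0
    have h32 := sub_mem_of_isIsomorphic dualProdBasis h0 hfJ hg₃ hg₂
      (Quotient.exact (hX₃.trans hX₂.symm)) 1
    rw [tangentClass_mk h0 hfJ ((key _ _ _ _ hg₁).mp h₁),
      tangentClass_mk h0 hfJ ((key _ _ _ _ hg₂).mp h₂),
      tangentClass_mk h0 hfJ ((key _ _ _ _ hg₃).mp h₃), ← Submodule.Quotient.mk_add,
      Submodule.Quotient.eq]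
    change (_ : HolGerm 2) ∈ jacobianGerm f
    convert add_mem h31 h32 using 1
    simp
    ring
  · intro h
    obtain ⟨g, hg⟩ := Submodule.Quotient.mk_surjective _ (tangentClass h0 hfJ a)
    obtain ⟨g', hg'⟩ := Submodule.Quotient.mk_surjective _ (tangentClass h0 hfJ b)
    let G : Fin 2 → admissibleGerms f := ![g, g']
    let Z := deformationMk dualProdBasis h0 (g := fun i => (G i).1) fun i => (G i).2
    refine ⟨Quotient.mk _ Z, ⟨Z, dualDeformation h0 g, rfl, (tangentClass_bijective h0 hfJ).1 ?_,
      (key _ _ _ G rfl).mpr ?_⟩, ⟨Z, dualDeformation h0 g', rfl,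
      (tangentClass_bijective h0 hfJ).1 ?_, (key _ _ _ G rfl).mpr ?_⟩,
      ⟨Z, dualDeformation h0 (g + g'), rfl, (tangentClass_bijective h0 hfJ).1 ?_,
      (key _ _ _ G rfl).mpr ?_⟩⟩
    · rw [tangentClass_dualDeformation, hg]
    · simp [G]
      rfl
    · rw [tangentClass_dualDeformation, hg']
    · simp [G]
      rfl
    · rw [tangentClass_dualDeformation, ← h, ← hg, ← hg']
      rfl
    · simp [G]
      rfl

end Tangent

/-! ### Reducedness at the origin and the final rank -/

section Squarefree

open MvPolynomial

variable {f : MvPolynomial (Fin 2) ℂ}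

/-- Reducedness is assumed only for germs, so a squared factor becomes a unit of the local ring: it
may be nonconstant but cannot vanish at the origin. -/
theorem constantCoeff_ne_zero_of_mul_self_dvd (hred : Squarefree (polyGerm 2 f))
    {p : MvPolynomial (Fin 2) ℂ} (hp : p * p ∣ f) : constantCoeff p ≠ 0 := by
  have h := hred (polyGerm 2 p) (by rw [← map_mul]; exact map_dvd _ hp)
  have h1 := (h.map (convergent 2).val).map (MvPowerSeries.constantCoeff (R := ℂ) (σ := Fin 2))
  have h2 : MvPowerSeries.constantCoeff (polyGerm 2 p).1 = constantCoeff p := by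
    rw [coe_polyGerm, ← MvPowerSeries.coeff_zero_eq_constantCoeff_apply, coeff_coe,
      constantCoeff_eq]
  rw [← h2]
  exact h1.ne_zero

theorem rank_jacobianQuotient {d : ℕ} (hf : f.IsHomogeneous d) (hd : d ≠ 0)
    (hrel : IsRelPrime (pderiv 0 f) (pderiv 1 f)) :
    Module.rank ℂ (JacobianQuotient (1 : Fin 2 → ℕ) d f) =
      if 3 ≤ d then ((d - 3 : ℕ) : Cardinal) else 0 := by
  obtain ⟨d, rfl⟩ := Nat.exists_eq_succ_of_ne_zero hd
  have : Module.Finite ℂ (JacobianQuotient (1 : Fin 2 → ℕ) (d + 1) f) :=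
    Module.Finite.quotient _ _
  rw [← Module.finrank_eq_rank, finrank_jacobianQuotient hf hrel]
  split_ifs with h
  · rfl
  · rw [show d + 1 - 3 = 0 by omega, Nat.cast_zero]

end Squarefree

end FreeDivisor

end

theorem mainTheorem8 (w : Fin 2 → ℕ) (hw : ∀ i, 0 < w i) (k : ℕ) (f : MvPolynomial (Fin 2) ℂ)
    (hf : f.IsWeightedHomogeneous w k) (hf0 : MvPolynomial.constantCoeff f = 0)
    (hred : Squarefree (FreeDivisor.polyGerm 2 f)) :
    ∃ (_ : AddCommGroup (FreeDivisor.FT1 (FreeDivisor.polyGerm 2 f)))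
      (_ : Module ℂ (FreeDivisor.FT1 (FreeDivisor.polyGerm 2 f))),
      (∀ a b c : FreeDivisor.FT1 (FreeDivisor.polyGerm 2 f),
        a + b = c ↔ FreeDivisor.FT1.IsSum a b c) ∧
      (∀ (t : ℂ) (a b : FreeDivisor.FT1 (FreeDivisor.polyGerm 2 f)),
        t • a = b ↔ FreeDivisor.FT1.IsSMul t a b) ∧
      Nonempty (FreeDivisor.FT1 (FreeDivisor.polyGerm 2 f) ≃ₗ[ℂ]
        FreeDivisor.JacobianQuotient w k f) ∧
      (∀ d : ℕ, f.IsHomogeneous d →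
        Module.rank ℂ (FreeDivisor.FT1 (FreeDivisor.polyGerm 2 f)) =
          if 3 ≤ d then ((d - 3 : ℕ) : Cardinal) else 0) := by
  open FreeDivisor in
  have hw' : ∀ i, w i ≠ 0 := fun i => (hw i).ne'
  have h0 : polyGerm 2 f ≠ 0 := hred.ne_zero
  have hf_ne : f ≠ 0 := fun h => h0 (by rw [h, map_zero])
  have hk := ne_zero_of_constantCoeff_eq_zero hf hf_ne hf0 hw'
  have hrel := isRelPrime_pderiv hw' hf hf_ne hk fun p hp =>
    constantCoeff_ne_zero_of_mul_self_dvd hred hp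
  have hne : MvPolynomial.pderiv 0 f ≠ 0 ∨ MvPolynomial.pderiv 1 f ≠ 0 := by
    by_contra! h
    rw [h.1, h.2] at hrel
    exact not_isUnit_zero (isRelPrime_zero_left.mp hrel)
  obtain ⟨N, hN⟩ := exists_X_pow_mem_jacobianIdeal hw' hf hrel hne 0
  obtain ⟨M, hM⟩ := exists_X_pow_mem_jacobianIdeal hw' hf hrel hne 1
  have hfJ := polyGerm_mem_jacobianGerm hf hk
  -- The vector space structure is transported along this bijection; `isSum_iff` and `isSMul_iff`
  -- show that it is the prescribed one.
  let e := Equiv.ofBijective _ (tangentClass_bijective h0 hfJ)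
  let _ : AddCommGroup (FT1 (polyGerm 2 f)) := e.addCommGroup
  let _ : Module ℂ (FT1 (polyGerm 2 f)) := e.module ℂ
  let E : FT1 (polyGerm 2 f) ≃ₗ[ℂ] AdmissibleTangent f := e.linearEquiv ℂ
  refine ⟨inferInstance, inferInstance, fun a b c => ?_, fun t a b => ?_, ?_, fun d hd => ?_⟩
  · rw [isSum_iff h0 hfJ, ← E.injective.eq_iff, map_add]
    rfl
  · rw [isSMul_iff h0 hfJ, ← E.injective.eq_iff, map_smul]
    rfl
  · obtain ⟨ψ⟩ := nonempty_admissibleTangent_equiv hf hk hN hM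
    exact ⟨E.trans ψ⟩
  · have hd0 : d ≠ 0 := ne_zero_of_constantCoeff_eq_zero hd hf_ne hf0 (by simp)
    -- `AdmissibleTangent f` does not depend on the weights, so the computation can be repeated with
    -- both weights equal to 1.
    obtain ⟨ψ⟩ := nonempty_admissibleTangent_equiv hd hd0 hN hM
    rw [(E.trans ψ).rank_eq, rank_jacobianQuotient hd hd0 hrel]
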